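/- Let $T>0$, $r\neq 0$, $v\in\mathbb{R}$, $\sigma>0$, $\rho>0$, $\theta\ge 0$, and let $B$ be a standard Brownian motion on $[0,T]$ on a complete filtered probability space. Two households $i=1,2$ have constants $\alpha_i,\beta_i,\gamma_i>0$ and $x_i\in\mathbb{R}$. A decision is a pair $(I,C)$ of deterministic functions on $[0,T]$ with $I$ square integrable and $C$ integrable and everywhere positive. The fund process $X$ of household $i$ under $(I,C)$ is the continuous adapted solution of $$dX(t)=[rX(t)+vI(t)-C(t)]\,dt+\sigma I(t)\,dB(t),\qquad X(0)=x_i .$$ Let $$\bar J_i(I,C)=\mathbb{E}\Big[-\tfrac1{\alpha_i}e^{-\alpha_iX(T)}\Big]+\gamma_i\int_0^T-\tfrac1{\beta_i}e^{-\rho rt-\beta_iC(t)}\,dt .$$ Let $(\bar I_i,\bar C_i)$ be a decision that maximizes $\bar J_i$ over all decisions (the rational decision of household $i$), for $i=1,2$, and let $(I_1^*,C_1^*)$ be a decision that maximizes $$\bar J_1(I,C)-\frac{\theta}{2}\int_0^Te^{\rho r(T-t)}[I(t)-\bar I_2(t)]^2\,dt$$ over all decisions (the optimal decision of household $1$ when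 it follows household $2$ with herd coefficient $\theta$). Then the crowding-out consumption $\mathscr{C}=\bar C_1(t)-C_1^*(t)$ does not depend on $t$: there is a constant $\mathscr{C}$ such that this equality holds for almost every $t\in[0,T]$, and for every $t\in[0,T]$ if $\bar C_1$ and $C_1^*$ are continuous. Moreover $$\mathscr{C}=\frac{\alpha_1\sigma^2}{2}\left(\frac{\beta_1}{\alpha_1}+\frac{e^{rT}-1}{r}\right)^{-1}\int_0^Te^{2r(T-t)}[I_1^*(t)-\bar I_1(t)]^2\,dt\ \ge\ 0 .$$ In particular, herding never raises consumption. -/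

import Mathlib

open MeasureTheory ProbabilityTheory Filter Topology Set
open scoped ENNReal

noncomputable section

namespace Herding

/-- The data of the market and of the planning problem: interest rate `r`, excess return rate `v`,
volatility `σ`, time horizon `[0, T]` and decay coefficient `ρ`. -/
structure Market where
  r : ℝ
  v : ℝ
  σ : ℝ
  T : ℝ
  ρ : ℝ

/-- The data of a household: risk aversion coefficient `α`, diminishing marginal coefficient `β`,
consumption weight coefficient `γ` and initial fund `x`. -/
structure Household where
  α : ℝ
  β : ℝ
  γ : ℝ
  x : ℝ

variable {Ω : Type*} [mΩ : MeasurableSpace Ω]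

/-- `B` is a standard Brownian motion on `[0, T]` with respect to the filtration `𝓕` (of which only
the times in `[0, T]` matter): it is adapted, starts at `0`, has continuous paths, and for
`0 ≤ s ≤ t ≤ T` the increment `B t - B s` is independent of `𝓕 s` with law `N(0, t - s)`. -/
structure IsBrownianOn (P : Measure Ω) (𝓕 : Filtration ℝ mΩ) (T : ℝ) (B : ℝ → Ω → ℝ) : Prop where
  adapted : ∀ t ∈ Icc 0 T, Measurable[𝓕 t] (B t)
  start : ∀ᵐ ω ∂P, B 0 ω = 0
  continuous_paths : ∀ᵐ ω ∂P, ContinuousOn (fun t => B t ω) (Icc 0 T)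
  indep_increments : ∀ s t, 0 ≤ s → s ≤ t → t ≤ T →
    Indep (MeasurableSpace.comap (fun ω => B t ω - B s ω) inferInstance) (𝓕 s) P
  law_increments : ∀ s t, 0 ≤ s → s ≤ t → t ≤ T →
    HasLaw (fun ω => B t ω - B s ω) (gaussianReal 0 (t - s).toNNReal) P

/-- A deterministic step function: the finite linear combination of the indicators of the intervals
`(left i, right i]`, `i < n`, with the coefficients `val i`. -/
structure Step where
  n : ℕ
  left : ℕ → ℝ
  right : ℕ → ℝ
  val : ℕ → ℝ
  le : ∀ i, left i ≤ right i

/-- The step function as a function of time. -/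
def Step.toFun (S : Step) (u : ℝ) : ℝ :=
  ∑ i ∈ Finset.range S.n, (Ioc (S.left i) (S.right i)).indicator (fun _ => S.val i) u

/-- The stochastic integral `∫ S dB` of a step function. -/
def Step.integral (S : Step) (B : ℝ → Ω → ℝ) (ω : Ω) : ℝ :=
  ∑ i ∈ Finset.range S.n, S.val i * (B (S.right i) ω - B (S.left i) ω)

/-- `Y` is (a version of) the Itô integral `∫₀ᵗ f(s) dB(s)` of the deterministic function `f`:
it is the limit in `L²(P)` of the integrals of step functions on `[0, t]` that converge to `f` in
`L²([0, t])`. -/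
def IsItoIntegral (P : Measure Ω) (B : ℝ → Ω → ℝ) (t : ℝ) (f : ℝ → ℝ) (Y : Ω → ℝ) : Prop :=
  MemLp Y 2 P ∧ ∃ S : ℕ → Step, (∀ k i, 0 ≤ (S k).left i ∧ (S k).right i ≤ t) ∧
    Tendsto (fun k => eLpNorm (fun u => (S k).toFun u - f u) 2 (volume.restrict (Icc 0 t)))
      atTop (𝓝 0) ∧
    Tendsto (fun k => eLpNorm (fun ω => (S k).integral B ω - Y ω) 2 P) atTop (𝓝 0)

/-- The decisions of a household are deterministic functions of time: a square integrable
investment decision `I` and an integrable, everywhere positive consumption decision `C`. -/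
structure IsDecision (T : ℝ) (I C : ℝ → ℝ) : Prop where
  investment : MemLp I 2 (volume.restrict (Icc 0 T))
  consumption : IntegrableOn C (Icc 0 T)
  consumption_pos : ∀ t ∈ Icc 0 T, 0 < C t

/-- `X` is a fund process with initial fund `x` under the decisions `I`, `C`: an adapted process
with continuous paths that solves `dX = (r X + v I - C) dt + σ I dB`, `X(0) = x`, on `[0, T]`. -/
structure IsFundProcess (P : Measure Ω) (𝓕 : Filtration ℝ mΩ) (B : ℝ → Ω → ℝ) (M : Market)
    (x : ℝ) (I C : ℝ → ℝ) (X : ℝ → Ω → ℝ) : Prop where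
  adapted : ∀ t ∈ Icc 0 M.T, Measurable[𝓕 t] (X t)
  continuous_paths : ∀ᵐ ω ∂P, ContinuousOn (fun t => X t ω) (Icc 0 M.T)
  start : ∀ᵐ ω ∂P, X 0 ω = x
  equation : ∀ t ∈ Icc 0 M.T, ∃ Y : Ω → ℝ, IsItoIntegral P B t I Y ∧
    ∀ᵐ ω ∂P, X t ω = x + (∫ s in (0 : ℝ)..t, (M.r * X s ω + M.v * I s - C s)) + M.σ * Y ω

/-- The fund utility `φ`. -/
def fundUtility (H : Household) (z : ℝ) : ℝ :=
  -(1 / H.α) * Real.exp (-H.α * z)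

/-- The consumption utility `ψ`. -/
def consumptionUtility (M : Market) (H : Household) (t c : ℝ) : ℝ :=
  -(1 / H.β) * Real.exp (-M.ρ * M.r * t - H.β * c)

/-- The objective without herding, for a consumption decision `C` and the fund process `X`. -/
def rationalObjective (P : Measure Ω) (M : Market) (H : Household) (C : ℝ → ℝ)
    (X : ℝ → Ω → ℝ) : ℝ :=
  (∫ ω, fundUtility H (X M.T ω) ∂P)
    + H.γ * ∫ t in (0 : ℝ)..M.T, consumptionUtility M H t (C t)

/-- The average deviation `D` of the investment decision `I` from `I'`. -/
def averageDeviation (M : Market) (I I' : ℝ → ℝ) : ℝ :=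
  1 / 2 * ∫ t in (0 : ℝ)..M.T, Real.exp (M.ρ * M.r * (M.T - t)) * (I t - I' t) ^ 2

/-- The objective of a household that follows the investment decision `I'` with herd
coefficient `θ`. -/
def herdingObjective (P : Measure Ω) (M : Market) (H : Household) (θ : ℝ) (I' : ℝ → ℝ)
    (I C : ℝ → ℝ) (X : ℝ → Ω → ℝ) : ℝ :=
  rationalObjective P M H C X - θ * averageDeviation M I I'

/-- `(I, C)` is a rational decision of the household `H`: it maximizes the objective without
herding over all decisions, subject to the fund equation with initial fund `H.x`. -/
def IsRationalDecision (P : Measure Ω) (𝓕 : Filtration ℝ mΩ) (B : ℝ → Ω → ℝ) (M : Market)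
    (H : Household) (I C : ℝ → ℝ) : Prop :=
  IsDecision M.T I C ∧ ∃ X : ℝ → Ω → ℝ, IsFundProcess P 𝓕 B M H.x I C X ∧
    ∀ (I₀ C₀ : ℝ → ℝ) (X₀ : ℝ → Ω → ℝ), IsDecision M.T I₀ C₀ →
      IsFundProcess P 𝓕 B M H.x I₀ C₀ X₀ →
      rationalObjective P M H C₀ X₀ ≤ rationalObjective P M H C X

/-- `(I, C)` is an optimal decision of the household `H` that follows the investment decision `I'`
with herd coefficient `θ`: it maximizes the objective with herding over all decisions, subject to
the fund equation with initial fund `H.x`. -/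
def IsHerdingDecision (P : Measure Ω) (𝓕 : Filtration ℝ mΩ) (B : ℝ → Ω → ℝ) (M : Market)
    (H : Household) (θ : ℝ) (I' : ℝ → ℝ) (I C : ℝ → ℝ) : Prop :=
  IsDecision M.T I C ∧ ∃ X : ℝ → Ω → ℝ, IsFundProcess P 𝓕 B M H.x I C X ∧
    ∀ (I₀ C₀ : ℝ → ℝ) (X₀ : ℝ → Ω → ℝ), IsDecision M.T I₀ C₀ →
      IsFundProcess P 𝓕 B M H.x I₀ C₀ X₀ →
      herdingObjective P M H θ I' I₀ C₀ X₀ ≤ herdingObjective P M H θ I' I C X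

end Herding

end

noncomputable section

namespace Herding

/-! ### The exponential kernel of a linear differential equation -/

/-! The stochastic problem collapses to a deterministic one. By variation of constants, X(T) is a
constant plus σ times the Wiener integral of e^{r(T-t)} I(t), hence Gaussian
(`IsFundProcess.terminal_ae_eq`). Its expected utility is therefore -(1/α) e^L, where L =
`logMarginal` is -α times the mean plus α²/2 times the variance
(`IsFundProcess.integral_fundUtility`).

The herding penalty involves only I. Both optimal consumptions thus satisfy the same condition γ
e^{-ρrt-βC(t)} = e^L e^{r(T-t)} (`consumption_foc`), each with its own L. In the difference of the
logarithms everything that depends on t cancels, except the consumptions: β c = L* - L̄, so c is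
constant.

The rational investment satisfies ασ² e^{r(T-t)} Ī(t) = v (`investment_foc`). Completing the square
around it (`logMarginal_sub_logMarginal`) gives L* - L̄ = (α²σ²/2) Q - α c ∫ e^{r(T-t)} dt, where Q
is the weighted square distance of I* from Ī. Together the two relations form a linear equation for
c. No formula for I* is needed.

Both first order conditions compare the optimum with explicit competitors, whose fund processes are
built in `IsFundProcess.exists_perturbation`. -/

theorem integral_exp_mul_primitive {k : ℝ → ℝ} {t : ℝ} (r : ℝ)
    (hk : IntervalIntegrable k volume 0 t) :
    r * ∫ s in (0 : ℝ)..t, Real.exp (r * (t - s)) * ∫ u in (0 : ℝ)..s, k u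
      = ∫ u in (0 : ℝ)..t, (Real.exp (r * (t - u)) - 1) * k u := by
  set φ : ℝ → ℝ := fun s => -Real.exp (r * (t - s)) with hφ
  have hφd : ∀ s, HasDerivAt φ (r * Real.exp (r * (t - s))) s := fun s => by
    have h := (((hasDerivAt_id s).const_sub t).const_mul r).exp.neg
    refine h.congr_deriv ?_
    simp only [id]; ring
  -- As `k` is merely integrable, its primitive is differentiable only almost everywhere;
  -- integration by parts is used in its absolutely continuous form.
  have hφac : AbsolutelyContinuousOnInterval φ 0 t :=
    ContDiffOn.absolutelyContinuousOnInterval (by fun_prop)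
  have hgac := hk.absolutelyContinuousOnInterval_intervalIntegral (c := 0) (by simp)
  have hparts := hφac.integral_mul_deriv_eq_deriv_mul hgac
  have h1 : ∫ x in (0 : ℝ)..t, φ x * deriv (fun x => ∫ v in (0 : ℝ)..x, k v) x
      = ∫ x in (0 : ℝ)..t, φ x * k x := by
    apply intervalIntegral.integral_congr_ae
    filter_upwards [hk.ae_hasDerivAt_integral] with x hx hx'
    rw [(hx (uIoc_subset_uIcc hx') 0 (by simp)).deriv]
  have h2 : ∫ x in (0 : ℝ)..t, deriv φ x * ∫ v in (0 : ℝ)..x, k v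
      = r * ∫ s in (0 : ℝ)..t, Real.exp (r * (t - s)) * ∫ u in (0 : ℝ)..s, k u := by
    rw [← intervalIntegral.integral_const_mul]
    congr 1 with x
    rw [(hφd x).deriv]; ring
  have h3 : ∫ u in (0 : ℝ)..t, (Real.exp (r * (t - u)) - 1) * k u
      = -(∫ x in (0 : ℝ)..t, φ x * k x) - ∫ x in (0 : ℝ)..t, k x := by
    rw [← intervalIntegral.integral_neg, ← intervalIntegral.integral_sub]
    · congr 1 with x
      simp only [hφ]; ring
    · exact (hk.continuousOn_mul (by fun_prop)).neg
    · exact hk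
  rw [h1, h2] at hparts
  rw [h3]
  simp only [hφ, sub_self, mul_zero, Real.exp_zero, intervalIntegral.integral_same] at hparts ⊢
  linarith

/-- Variation of constants: a function is recovered from `n t = q t - r ∫₀ᵗ q`. -/
theorem eq_add_integral_exp {q n : ℝ → ℝ} {t : ℝ} (r : ℝ) (ht : 0 ≤ t)
    (hq : ContinuousOn q (Icc 0 t))
    (hn : ∀ s ∈ Icc 0 t, n s = q s - r * ∫ u in (0 : ℝ)..s, q u) :
    q t = n t + r * ∫ s in (0 : ℝ)..t, Real.exp (r * (t - s)) * n s := by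
  have hqi : IntervalIntegrable q volume 0 t := hq.intervalIntegrable_of_Icc ht
  have hQ : IntervalIntegrable (fun s => ∫ u in (0 : ℝ)..s, q u) volume 0 t := by
    refine ContinuousOn.intervalIntegrable ?_
    exact intervalIntegral.continuousOn_primitive_interval'  hqi (by simp)
  have e1 : ∫ s in (0 : ℝ)..t, Real.exp (r * (t - s)) * n s
      = (∫ s in (0 : ℝ)..t, Real.exp (r * (t - s)) * q s)
        - r * ∫ s in (0 : ℝ)..t, Real.exp (r * (t - s)) * ∫ u in (0 : ℝ)..s, q u := by
    rw [← intervalIntegral.integral_const_mul, ← intervalIntegral.integral_sub]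
    · refine intervalIntegral.integral_congr fun s hs => ?_
      rw [uIcc_of_le ht] at hs
      simp only [hn s hs]; ring
    · exact hqi.continuousOn_mul (by fun_prop)
    · exact (hQ.continuousOn_mul (by fun_prop)).const_mul r
  have e2 : ∫ u in (0 : ℝ)..t, (Real.exp (r * (t - u)) - 1) * q u
      = (∫ s in (0 : ℝ)..t, Real.exp (r * (t - s)) * q s) - ∫ u in (0 : ℝ)..t, q u := by
    rw [← intervalIntegral.integral_sub]
    · congr 1 with x; ring
    · exact hqi.continuousOn_mul (by fun_prop)
    · exact hqi
  -- The weighted integral of `n` collapses to `∫ q`.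
  rw [e1, integral_exp_mul_primitive r hqi, e2, hn t (right_mem_Icc.2 ht)]
  ring

/-- The solution `z = n + r ∫₀ᵗ e^{r (t - s)} n(s) ds` of `z t = n t + r ∫₀ᵗ z`. -/
theorem integral_add_integral_exp {n : ℝ → ℝ} (r t : ℝ) (hn : Continuous n) :
    ∫ s in (0 : ℝ)..t, (n s + r * (Real.exp (r * s) * ∫ u in (0 : ℝ)..s, Real.exp (-r * u) * n u))
      = Real.exp (r * t) * ∫ u in (0 : ℝ)..t, Real.exp (-r * u) * n u := by
  have hc : Continuous fun u => Real.exp (-r * u) * n u := by fun_prop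
  have hd : ∀ s, HasDerivAt
      (fun s => Real.exp (r * s) * ∫ u in (0 : ℝ)..s, Real.exp (-r * u) * n u)
      (n s + r * (Real.exp (r * s) * ∫ u in (0 : ℝ)..s, Real.exp (-r * u) * n u)) s := fun s => by
    have h1 : HasDerivAt (fun s => Real.exp (r * s)) (Real.exp (r * s) * (r * 1)) s :=
      ((hasDerivAt_id s).const_mul r).exp
    have h2 : HasDerivAt (fun s => ∫ u in (0 : ℝ)..s, Real.exp (-r * u) * n u)
        (Real.exp (-r * s) * n s) s :=
      intervalIntegral.integral_hasDerivAt_right (hc.intervalIntegrable _ _)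
        (hc.stronglyMeasurableAtFilter _ _) hc.continuousAt
    refine (h1.mul h2).congr_deriv ?_
    have : Real.exp (r * s) * Real.exp (-r * s) = 1 := by
      rw [← Real.exp_add]; simp
    linear_combination n s * this
  have hcont : Continuous fun s =>
      Real.exp (r * s) * ∫ u in (0 : ℝ)..s, Real.exp (-r * u) * n u :=
    continuous_iff_continuousAt.2 fun s => (hd s).continuousAt
  rw [intervalIntegral.integral_eq_sub_of_hasDerivAt (fun s _ => hd s)
    ((hn.add (hcont.const_mul r)).intervalIntegrable _ _)]
  simp

/-! ### Indicators of initial intervals are total in `L²([0, T])` -/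

/-- By Lebesgue differentiation `f` is almost everywhere the derivative of its primitive, which
vanishes near every interior point. -/
theorem ae_eq_zero_of_forall_integral_eq_zero {f : ℝ → ℝ} {T : ℝ} (hT : 0 ≤ T)
    (hf : IntervalIntegrable f volume 0 T) (h : ∀ b ∈ Icc 0 T, ∫ t in (0 : ℝ)..b, f t = 0) :
    f =ᵐ[volume.restrict (Icc 0 T)] 0 := by
  rw [← restrict_Ioo_eq_restrict_Icc]
  rw [Filter.EventuallyEq, ae_restrict_iff' measurableSet_Ioo]
  filter_upwards [hf.ae_hasDerivAt_integral] with x hx hx'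
  have hx1 : x ∈ uIcc 0 T := by rw [uIcc_of_le hT]; exact Ioo_subset_Icc_self hx'
  have h1 := hx hx1 0 (by simp)
  have h2 : HasDerivAt (fun x => ∫ t in (0 : ℝ)..x, f t) 0 x := by
    refine (hasDerivAt_const x (0 : ℝ)).congr_of_eventuallyEq ?_
    filter_upwards [Icc_mem_nhds hx'.1 hx'.2] with y hy using h y hy
  exact h1.unique h2

/-- The class of the indicator of `(0, a]` in `L²([0, T])`. -/
def initialIndicator (T : ℝ) (a : Icc (0 : ℝ) T) : Lp ℝ 2 (volume.restrict (Icc (0 : ℝ) T)) :=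
  indicatorConstLp 2 (measurableSet_Ioc : MeasurableSet (Ioc (0 : ℝ) a)) (measure_ne_top _ _) 1

/-- This Gram matrix is the covariance of Brownian motion; the match is what makes the Wiener
integral an isometry. -/
theorem inner_initialIndicator {T : ℝ} (a b : Icc (0 : ℝ) T) :
    inner ℝ (initialIndicator T a) (initialIndicator T b) = min (a : ℝ) b := by
  rw [initialIndicator, initialIndicator, L2.inner_indicatorConstLp_indicatorConstLp]
  have : (Ioc (0 : ℝ) a ∩ Ioc 0 b) ∩ Icc 0 T = Ioc 0 (min (a : ℝ) b) := by
    have := a.2.2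
    ext x; simp only [mem_inter_iff, mem_Ioc, mem_Icc, le_min_iff]; grind
  rw [measureReal_restrict_apply (measurableSet_Ioc.inter measurableSet_Ioc), this]
  rw [Measure.real, Real.volume_Ioc, sub_zero, ENNReal.toReal_ofReal (le_min a.2.1 b.2.1)]
  simp

theorem inner_initialIndicator_left {T : ℝ} (b : Icc (0 : ℝ) T)
    (f : Lp ℝ 2 (volume.restrict (Icc (0 : ℝ) T))) :
    inner ℝ (initialIndicator T b) f = ∫ t in (0 : ℝ)..b, f t := by
  rw [initialIndicator, L2.inner_indicatorConstLp_one, intervalIntegral.integral_of_le b.2.1,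
    Measure.restrict_restrict measurableSet_Ioc, inter_eq_self_of_subset_left]
  exact Ioc_subset_Icc_self.trans (Icc_subset_Icc_right b.2.2)

/-- A function orthogonal to all these indicators has zero primitive on `[0, T]`, so it is zero. -/
theorem denseRange_initialIndicator {T : ℝ} (hT : 0 ≤ T) :
    DenseRange (Finsupp.linearCombination ℝ (initialIndicator T)) := by
  have h : (LinearMap.range (Finsupp.linearCombination ℝ (initialIndicator T))).topologicalClosure
      = ⊤ := by
    rw [Submodule.topologicalClosure_eq_top_iff, Submodule.eq_bot_iff]
    intro f hf
    have hi : IntervalIntegrable f volume 0 T := by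
      rw [intervalIntegrable_iff_integrableOn_Icc_of_le hT]
      exact (Lp.memLp f).integrable one_le_two
    refine (Lp.eq_zero_iff_ae_eq_zero).2 (ae_eq_zero_of_forall_integral_eq_zero hT hi ?_)
    intro b hb
    rw [← inner_initialIndicator_left ⟨b, hb⟩ f]
    exact (Submodule.mem_orthogonal _ _).1 hf _
      ⟨Finsupp.single ⟨b, hb⟩ 1, by simp⟩
  have := Submodule.dense_iff_topologicalClosure_eq_top.2 h
  simpa [DenseRange, LinearMap.coe_range] using this

/-- Families with the same Gram matrix have isometric linear spans. -/
theorem inner_linearCombination_eq_of_gram {ι E F : Type*} [NormedAddCommGroup E]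
    [InnerProductSpace ℝ E] [NormedAddCommGroup F] [InnerProductSpace ℝ F] {u : ι → E} {w : ι → F}
    (h : ∀ i j, inner ℝ (u i) (u j) = inner ℝ (w i) (w j)) (e : ι →₀ ℝ) :
    ‖Finsupp.linearCombination ℝ u e‖ = ‖Finsupp.linearCombination ℝ w e‖ := by
  have : inner ℝ (Finsupp.linearCombination ℝ u e) (Finsupp.linearCombination ℝ u e)
      = inner ℝ (Finsupp.linearCombination ℝ w e) (Finsupp.linearCombination ℝ w e) := by
    simp only [Finsupp.linearCombination_apply, Finsupp.sum, inner_sum, sum_inner, inner_smul_left,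
      inner_smul_right, h]
  rw [real_inner_self_eq_norm_sq, real_inner_self_eq_norm_sq] at this
  exact (sq_eq_sq₀ (norm_nonneg _) (norm_nonneg _)).1 this

variable {Ω : Type*} [mΩ : MeasurableSpace Ω]

/-! ### Gaussian laws of linear combinations of Brownian values -/

section Brownian

variable {P : Measure Ω} {𝓕 : Filtration ℝ mΩ} {T : ℝ} {B : ℝ → Ω → ℝ}

theorem IsBrownianOn.indepFun_of_measurable (hB : IsBrownianOn P 𝓕 T B) {s t : ℝ} (hs : 0 ≤ s)
    (hst : s ≤ t) (ht : t ≤ T) {U : Ω → ℝ} (hU : Measurable[𝓕 s] U) :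
    IndepFun U (fun ω => B t ω - B s ω) P := by
  have h := (hB.indep_increments s t hs hst ht).symm
  rw [IndepFun_iff_Indep]
  exact indep_of_indep_of_le_left h hU.comap_le

/-- Induction on the largest time: the last increment is independent of the past, and a sum of
independent Gaussians is Gaussian. The variance is left open here because the isometry identifies it
later. -/
theorem IsBrownianOn.exists_hasLaw_sum (hB : IsBrownianOn P 𝓕 T B) [IsProbabilityMeasure P]
    (I : Finset ℝ) : (∀ a ∈ I, a ∈ Icc 0 T) → ∀ c : ℝ → ℝ,
      ∃ v, HasLaw (fun ω => ∑ a ∈ I, c a * B a ω) (gaussianReal 0 v) P := by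
  classical
  induction I using Finset.induction_on_max with
  | empty =>
    intro _ c
    refine ⟨0, ⟨by simp [aemeasurable_const], ?_⟩⟩
    simp
  | insert b I hb ih =>
    intro hI c
    have hbI : b ∉ I := fun h => lt_irrefl _ (hb b h)
    have hbT := hI b (Finset.mem_insert_self _ _)
    have hI' : ∀ a ∈ I, a ∈ Icc 0 T := fun a ha => hI a (Finset.mem_insert_of_mem ha)
    -- `m` is the time preceding `b`, and `c'` absorbs `c b * B m` into the coefficient at `m`. If
    -- no time precedes `b`, then `m = 0`, where `B` vanishes almost surely.
    obtain ⟨m, hm0, hmb, hmI, c', hc'⟩ : ∃ m : ℝ, 0 ≤ m ∧ m ≤ b ∧ (∀ a ∈ I, a ≤ m) ∧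
        ∃ c' : ℝ → ℝ, ∀ᵐ ω ∂P, ∑ a ∈ insert b I, c a * B a ω
          = ∑ a ∈ I, c' a * B a ω + c b * (B b ω - B m ω) := by
      rcases I.eq_empty_or_nonempty with rfl | hne
      · refine ⟨0, le_rfl, hbT.1, by simp, c, ?_⟩
        filter_upwards [hB.start] with ω hω
        simp [hω]
      · refine ⟨I.max' hne, (hI' _ (I.max'_mem hne)).1, (hb _ (I.max'_mem hne)).le,
          fun a ha => I.le_max' a ha, fun a => c a + if a = I.max' hne then c b else 0, ?_⟩
        refine ae_of_all _ fun ω => ?_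
        rw [Finset.sum_insert hbI]
        simp only [add_mul, Finset.sum_add_distrib, ite_mul, zero_mul, Finset.sum_ite_eq',
          I.max'_mem hne, if_true]
        ring
    obtain ⟨v, hv⟩ := ih hI' c'
    have hmeas : Measurable[𝓕 m] fun ω => ∑ a ∈ I, c' a * B a ω := by
      refine Finset.measurable_fun_sum _ fun a ha => ?_
      exact ((hB.adapted a (hI' a ha)).mono (𝓕.mono (hmI a ha)) le_rfl).const_mul _
    have hind := (hB.indepFun_of_measurable hm0 hmb hbT.2 hmeas).comp measurable_id
      (measurable_const_mul (c b))
    have hlaw := gaussianReal_const_mul (hB.law_increments m b hm0 hmb hbT.2) (c b)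
    have hsum := gaussianReal_add_gaussianReal_of_indepFun hind hv.map_eq hlaw.map_eq
    rw [mul_zero, add_zero] at hsum
    exact ⟨_, HasLaw.congr ⟨hv.aemeasurable.add hlaw.aemeasurable, hsum⟩ hc'⟩

theorem IsBrownianOn.hasLaw_eval (hB : IsBrownianOn P 𝓕 T B) (a : Icc (0 : ℝ) T) :
    HasLaw (B a) (gaussianReal 0 (a : ℝ).toNNReal) P := by
  have h := hB.law_increments 0 a le_rfl a.2.1 a.2.2
  rw [sub_zero] at h
  refine h.congr ?_
  filter_upwards [hB.start] with ω hω
  simp [hω]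

theorem IsBrownianOn.memLp_eval (hB : IsBrownianOn P 𝓕 T B) (a : Icc (0 : ℝ) T) :
    MemLp (B a) 2 P :=
  (hB.hasLaw_eval a).hasGaussianLaw.memLp_two

/-- The class of `B a` in `L²(P)`. -/
def IsBrownianOn.evalLp (hB : IsBrownianOn P 𝓕 T B) (a : Icc (0 : ℝ) T) : Lp ℝ 2 P :=
  (hB.memLp_eval a).toLp (B a)

/-- Split `B b` as `B a` plus an increment independent of `B a` and of mean zero. -/
theorem IsBrownianOn.integral_mul_eval [IsProbabilityMeasure P] (hB : IsBrownianOn P 𝓕 T B)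
    (a b : Icc (0 : ℝ) T) (hab : a ≤ b) : ∫ ω, B a ω * B b ω ∂P = a := by
  have hm : ∀ a, AEStronglyMeasurable (B (a : Icc (0 : ℝ) T)) P := fun a =>
    (hB.memLp_eval a).1
  have h1 : ∫ ω, B a ω * (B b ω - B a ω) ∂P = 0 := by
    have hind := hB.indepFun_of_measurable a.2.1 hab b.2.2 (hB.adapted a a.2)
    rw [hind.integral_fun_mul_eq_mul_integral (hm a) ((hm b).sub (hm a)),
      (hB.hasLaw_eval a).integral_eq]
    simp
  have h2 : ∫ ω, B a ω * B a ω ∂P = a := by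
    have hv := (hB.hasLaw_eval a).variance_eq
    rw [variance_id_gaussianReal, variance_eq_sub (hB.memLp_eval a),
      (hB.hasLaw_eval a).integral_eq] at hv
    simp only [integral_id_gaussianReal, Real.coe_toNNReal _ a.2.1] at hv
    simpa [pow_two] using hv
  have hi : ∀ c : Icc (0 : ℝ) T, Integrable (fun ω => B a ω * B c ω) P := fun c =>
    (hB.memLp_eval a).integrable_mul (hB.memLp_eval c)
  simp only [mul_sub] at h1
  rw [integral_sub (hi b) (hi a)] at h1
  linarith

theorem IsBrownianOn.inner_evalLp [IsProbabilityMeasure P] (hB : IsBrownianOn P 𝓕 T B)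
    (a b : Icc (0 : ℝ) T) : inner ℝ (hB.evalLp a) (hB.evalLp b) = min (a : ℝ) b := by
  have key : ∀ a b : Icc (0 : ℝ) T,
      inner ℝ (hB.evalLp a) (hB.evalLp b) = ∫ ω, B a ω * B b ω ∂P := by
    intro a b
    rw [L2.inner_def]
    refine integral_congr_ae ?_
    filter_upwards [(hB.memLp_eval a).coeFn_toLp, (hB.memLp_eval b).coeFn_toLp] with ω h1 h2
    simp only [IsBrownianOn.evalLp, h1, h2, RCLike.inner_apply, conj_trivial, mul_comm]
  rcases le_total a b with h | h
  · rw [key, hB.integral_mul_eval a b h, min_eq_left (by exact h)]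
  · rw [real_inner_comm, key, hB.integral_mul_eval b a h, min_eq_right (by exact h)]

/-! ### The Wiener integral -/

/-- Both families have Gram matrix `min a b`. This bound allows the assignment of `B a` to the
indicator of `(0, a]` to be extended from the dense span to `L²([0, T])`. -/
theorem IsBrownianOn.norm_linearCombination [IsProbabilityMeasure P] (hB : IsBrownianOn P 𝓕 T B)
    (e : Icc (0 : ℝ) T →₀ ℝ) : ‖Finsupp.linearCombination ℝ hB.evalLp e‖
      = ‖Finsupp.linearCombination ℝ (initialIndicator T) e‖ :=
  inner_linearCombination_eq_of_gram
    (fun a b => by rw [hB.inner_evalLp, inner_initialIndicator]) e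

/-- The Wiener integral, as a continuous linear map from `L²([0, T])` to `L²(P)`. -/
def IsBrownianOn.wiener [IsProbabilityMeasure P] (hB : IsBrownianOn P 𝓕 T B) :
    Lp ℝ 2 (volume.restrict (Icc (0 : ℝ) T)) →L[ℝ] Lp ℝ 2 P :=
  (Finsupp.linearCombination ℝ hB.evalLp).extendOfNorm
    (Finsupp.linearCombination ℝ (initialIndicator T))

theorem IsBrownianOn.wiener_linearCombination [IsProbabilityMeasure P]
    (hB : IsBrownianOn P 𝓕 T B) (hT : 0 ≤ T) (e : Icc (0 : ℝ) T →₀ ℝ) :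
    hB.wiener (Finsupp.linearCombination ℝ (initialIndicator T) e)
      = Finsupp.linearCombination ℝ hB.evalLp e :=
  LinearMap.extendOfNorm_eq (denseRange_initialIndicator hT)
    ⟨1, fun e => by rw [hB.norm_linearCombination, one_mul]⟩ e

theorem IsBrownianOn.hasLaw_linearCombination [IsProbabilityMeasure P]
    (hB : IsBrownianOn P 𝓕 T B) (e : Icc (0 : ℝ) T →₀ ℝ) :
    HasLaw (Finsupp.linearCombination ℝ hB.evalLp e : Lp ℝ 2 P)
      (gaussianReal 0 (‖Finsupp.linearCombination ℝ (initialIndicator T) e‖₊ ^ 2)) P := by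
  classical
  set Z : Lp ℝ 2 P := Finsupp.linearCombination ℝ hB.evalLp e with hZ
  -- The coefficients are extended by `0` outside `[0, T]`, since the lemma takes a function on all
  -- of `ℝ`.
  obtain ⟨v, hv⟩ := hB.exists_hasLaw_sum (e.support.image Subtype.val) (by
    intro a ha
    obtain ⟨a', -, rfl⟩ := Finset.mem_image.1 ha
    exact a'.2) (fun a => if h : a ∈ Icc 0 T then e ⟨a, h⟩ else 0)
  have hZe : (Z : Ω → ℝ) =ᵐ[P] fun ω => ∑ a ∈ e.support.image Subtype.val,
      (if h : a ∈ Icc 0 T then e ⟨a, h⟩ else 0) * B a ω := by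
    have h1 : ∀ᵐ ω ∂P, ∀ a ∈ e.support, (e a • hB.evalLp a : Lp ℝ 2 P) ω = e a * B a ω := by
      refine (ae_ball_iff (Finset.countable_toSet _)).2 fun a _ => ?_
      filter_upwards [Lp.coeFn_smul (e a) (hB.evalLp a), (hB.memLp_eval a).coeFn_toLp]
        with ω h h'
      rw [h, Pi.smul_apply, smul_eq_mul, IsBrownianOn.evalLp, h']
    have h2 := Lp.coeFn_finsetSum (μ := P) e.support fun a => e a • hB.evalLp a
    rw [hZ, Finsupp.linearCombination_apply, Finsupp.sum]
    filter_upwards [h1, h2] with ω h1 h2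
    rw [h2, Finset.sum_apply, Finset.sum_image (fun _ _ _ _ h => Subtype.ext h)]
    refine Finset.sum_congr rfl fun a ha => ?_
    rw [h1 a ha, dif_pos a.2]
  have hlaw : HasLaw Z (gaussianReal 0 v) P := hv.congr hZe
  have hvar : (v : ℝ) = ‖Z‖ ^ 2 := by
    have h := hlaw.variance_eq
    rw [variance_id_gaussianReal, variance_eq_sub (Lp.memLp Z), hlaw.integral_eq] at h
    rw [← real_inner_self_eq_norm_sq, L2.inner_def, ← h]
    simp [pow_two]
  have : v = ‖Finsupp.linearCombination ℝ (initialIndicator T) e‖₊ ^ 2 := by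
    ext
    rw [hvar, hZ, hB.norm_linearCombination]
    simp
  rwa [← this]

/-- The map `x ↦ exp (i t x)` is `|t|`-Lipschitz, and the `L¹` norm is at most the `L²` norm on a
probability space. This makes characteristic functions continuous under `L²` limits. -/
theorem norm_integral_exp_sub_le [IsProbabilityMeasure P] (t : ℝ) (f g : Lp ℝ 2 P) :
    ‖(∫ ω, Complex.exp (Complex.I * (t * f ω : ℝ)) ∂P)
      - ∫ ω, Complex.exp (Complex.I * (t * g ω : ℝ)) ∂P‖ ≤ |t| * ‖f - g‖ := by
  have hm : ∀ f : Lp ℝ 2 P, Integrable (fun ω => Complex.exp (Complex.I * (t * f ω : ℝ))) P := by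
    intro f
    refine Integrable.of_bound (C := 1) ?_ (ae_of_all _ fun ω => ?_)
    · have := (Lp.aestronglyMeasurable f).aemeasurable
      exact AEMeasurable.aestronglyMeasurable (by fun_prop)
    · rw [mul_comm, Complex.norm_exp_ofReal_mul_I]
  rw [← integral_sub (hm f) (hm g)]
  have hint : Integrable (fun ω => ‖(f - g : Lp ℝ 2 P) ω‖) P :=
    ((Lp.memLp (f - g)).integrable one_le_two).norm
  calc _ ≤ ∫ ω, |t| * ‖(f - g : Lp ℝ 2 P) ω‖ ∂P := by
        refine norm_integral_le_of_norm_le (hint.const_mul _) ?_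
        filter_upwards [Lp.coeFn_sub f g] with ω hω
        have h1 : Complex.exp (Complex.I * (t * f ω : ℝ)) - Complex.exp (Complex.I * (t * g ω : ℝ))
            = Complex.exp ((t * g ω : ℝ) * Complex.I)
              * (Complex.exp (Complex.I * (t * (f ω - g ω) : ℝ)) - 1) := by
          rw [mul_sub, ← Complex.exp_add, mul_one, mul_comm _ Complex.I, ← mul_add]
          push_cast
          ring_nf
        rw [h1, norm_mul, Complex.norm_exp_ofReal_mul_I, one_mul, hω, Pi.sub_apply]
        refine Real.norm_exp_I_mul_ofReal_sub_one_le.trans ?_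
        rw [norm_mul, Real.norm_eq_abs]
    _ ≤ |t| * ‖f - g‖ := by
        rw [integral_const_mul]
        refine mul_le_mul_of_nonneg_left ?_ (abs_nonneg t)
        rw [Lp.norm_def, integral_norm_eq_lintegral_enorm (Lp.aestronglyMeasurable _),
          ← eLpNorm_one_eq_lintegral_enorm]
        exact ENNReal.toReal_mono (Lp.eLpNorm_ne_top _)
          (eLpNorm_le_eLpNorm_of_exponent_le one_le_two (Lp.aestronglyMeasurable _))

/-- At each frequency both characteristic functions are continuous in `f`, and they agree on the
dense span of the indicators. -/
theorem IsBrownianOn.hasLaw_wiener [IsProbabilityMeasure P] (hB : IsBrownianOn P 𝓕 T B)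
    (hT : 0 ≤ T) (f : Lp ℝ 2 (volume.restrict (Icc (0 : ℝ) T))) :
    HasLaw (hB.wiener f) (gaussianReal 0 (‖f‖₊ ^ 2)) P := by
  have hm : ∀ f, AEMeasurable (hB.wiener f) P := fun f => (Lp.aestronglyMeasurable _).aemeasurable
  have hchar : ∀ f t, charFun (P.map (hB.wiener f)) t
      = ∫ ω, Complex.exp (Complex.I * (t * hB.wiener f ω : ℝ)) ∂P := by
    intro f t
    rw [charFun_apply_real, integral_map (hm f) (by fun_prop)]
    refine integral_congr_ae (ae_of_all _ fun ω => ?_)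
    push_cast
    ring_nf
  refine ⟨hm f, Measure.ext_of_charFun (funext fun t => ?_)⟩
  have hcont : Continuous fun g : Lp ℝ 2 P =>
      ∫ ω, Complex.exp (Complex.I * (t * g ω : ℝ)) ∂P :=
    (LipschitzWith.of_dist_le_mul (K := ⟨|t|, abs_nonneg t⟩) fun f g => by
      rw [dist_eq_norm, dist_eq_norm]; exact norm_integral_exp_sub_le t f g).continuous
  induction f using (denseRange_initialIndicator hT).induction_on with
  | hp =>
    simp only [hchar, charFun_gaussianReal]
    exact isClosed_eq (hcont.comp hB.wiener.continuous) (by fun_prop)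
  | ih e =>
    rw [hB.wiener_linearCombination hT, (hB.hasLaw_linearCombination e).map_eq]

theorem IsBrownianOn.integral_exp_wiener [IsProbabilityMeasure P] (hB : IsBrownianOn P 𝓕 T B)
    (hT : 0 ≤ T) (f : Lp ℝ 2 (volume.restrict (Icc (0 : ℝ) T))) (c : ℝ) :
    ∫ ω, Real.exp (c * hB.wiener f ω) ∂P = Real.exp (c ^ 2 / 2 * ‖f‖ ^ 2) := by
  have := mgf_gaussianReal (hB.hasLaw_wiener hT f).map_eq c
  rw [mgf] at this
  rw [this]
  congr 1
  push_cast
  ring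

end Brownian

/-! ### Itô integrals of deterministic functions as Wiener integrals -/

section Ito

variable {P : Measure Ω} {𝓕 : Filtration ℝ mΩ} {T : ℝ} {B : ℝ → Ω → ℝ}

/-- The class in `L²([0, T])` of the restriction of `f` to `[0, t]`. -/
def windowLp {f : ℝ → ℝ} (hf : MemLp f 2 (volume.restrict (Icc (0 : ℝ) T))) (t : ℝ) :
    Lp ℝ 2 (volume.restrict (Icc (0 : ℝ) T)) :=
  (hf.indicator (measurableSet_Icc : MeasurableSet (Icc 0 t))).toLp _

theorem windowLp_coeFn {f : ℝ → ℝ} (hf : MemLp f 2 (volume.restrict (Icc (0 : ℝ) T))) (t : ℝ) :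
    windowLp hf t =ᵐ[volume.restrict (Icc 0 T)] (Icc 0 t).indicator f :=
  MemLp.coeFn_toLp _

theorem norm_windowLp_le {f : ℝ → ℝ} (hf : MemLp f 2 (volume.restrict (Icc (0 : ℝ) T))) (t : ℝ) :
    ‖windowLp hf t‖ ≤ ‖hf.toLp f‖ := by
  rw [windowLp, Lp.norm_toLp, Lp.norm_toLp]
  exact ENNReal.toReal_mono hf.2.ne (eLpNorm_indicator_le f)

/-- The increments of a step function, as a combination of times in `[0, T]`. -/
def Step.combination (S : Step) (hS : ∀ i, 0 ≤ S.left i ∧ S.right i ≤ T) : Icc (0 : ℝ) T →₀ ℝ :=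
  ∑ i ∈ Finset.range S.n, S.val i •
    (Finsupp.single ⟨S.right i, (hS i).1.trans (S.le i), (hS i).2⟩ 1
      - Finsupp.single ⟨S.left i, (hS i).1, (S.le i).trans (hS i).2⟩ 1)

/-- The indicator of `(a, b]` is a difference of two initial indicators. The same formal combination
evaluated on `evalLp` gives the stochastic integral of `S`, so `wiener` maps one to the other. -/
theorem Step.linearCombination_initialIndicator (S : Step)
    (hS : ∀ i, 0 ≤ S.left i ∧ S.right i ≤ T) :
    Finsupp.linearCombination ℝ (initialIndicator T) (S.combination hS)
      =ᵐ[volume.restrict (Icc 0 T)] S.toFun := by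
  simp only [Step.combination, map_sum, map_smul, map_sub, Finsupp.linearCombination_single,
    one_smul]
  have h : ∀ᵐ u ∂(volume.restrict (Icc 0 T)), ∀ i ∈ Finset.range S.n,
      (S.val i • (initialIndicator T ⟨S.right i, (hS i).1.trans (S.le i), (hS i).2⟩
        - initialIndicator T ⟨S.left i, (hS i).1, (S.le i).trans (hS i).2⟩) :
          Lp ℝ 2 (volume.restrict (Icc (0 : ℝ) T))) u
        = (Ioc (S.left i) (S.right i)).indicator (fun _ => S.val i) u := by
    refine (ae_ball_iff (Finset.countable_toSet _)).2 fun i _ => ?_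
    filter_upwards [Lp.coeFn_smul (S.val i)
        (initialIndicator T ⟨S.right i, (hS i).1.trans (S.le i), (hS i).2⟩
          - initialIndicator T ⟨S.left i, (hS i).1, (S.le i).trans (hS i).2⟩),
      Lp.coeFn_sub (initialIndicator T ⟨S.right i, (hS i).1.trans (S.le i), (hS i).2⟩)
        (initialIndicator T ⟨S.left i, (hS i).1, (S.le i).trans (hS i).2⟩),
      indicatorConstLp_coeFn (p := 2) (hs := (measurableSet_Ioc : MeasurableSet
        (Ioc (0 : ℝ) (S.right i)))) (hμs := measure_ne_top (volume.restrict (Icc 0 T)) _)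
        (c := (1 : ℝ)),
      indicatorConstLp_coeFn (p := 2) (hs := (measurableSet_Ioc : MeasurableSet
        (Ioc (0 : ℝ) (S.left i)))) (hμs := measure_ne_top (volume.restrict (Icc 0 T)) _)
        (c := (1 : ℝ))] with u h1 h2 h3 h4
    rw [h1, Pi.smul_apply, h2, Pi.sub_apply, initialIndicator, initialIndicator, h3, h4]
    have := hS i
    have := S.le i
    simp only [indicator_apply, mem_Ioc, smul_eq_mul]
    grind
  filter_upwards [h, Lp.coeFn_finsetSum (μ := volume.restrict (Icc (0 : ℝ) T)) (Finset.range S.n)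
    fun i => S.val i • (initialIndicator T ⟨S.right i, (hS i).1.trans (S.le i), (hS i).2⟩
        - initialIndicator T ⟨S.left i, (hS i).1, (S.le i).trans (hS i).2⟩)] with u h1 h2
  rw [h2, Finset.sum_apply, Step.toFun]
  exact Finset.sum_congr rfl h1

theorem Step.linearCombination_evalLp (hB : IsBrownianOn P 𝓕 T B) (S : Step)
    (hS : ∀ i, 0 ≤ S.left i ∧ S.right i ≤ T) :
    Finsupp.linearCombination ℝ hB.evalLp (S.combination hS) =ᵐ[P] S.integral B := by
  simp only [Step.combination, map_sum, map_smul, map_sub, Finsupp.linearCombination_single,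
    one_smul]
  have h : ∀ᵐ ω ∂P, ∀ i ∈ Finset.range S.n,
      (S.val i • (hB.evalLp ⟨S.right i, (hS i).1.trans (S.le i), (hS i).2⟩
        - hB.evalLp ⟨S.left i, (hS i).1, (S.le i).trans (hS i).2⟩) : Lp ℝ 2 P) ω
        = S.val i * (B (S.right i) ω - B (S.left i) ω) := by
    refine (ae_ball_iff (Finset.countable_toSet _)).2 fun i _ => ?_
    filter_upwards [Lp.coeFn_smul (S.val i)
        (hB.evalLp ⟨S.right i, (hS i).1.trans (S.le i), (hS i).2⟩
          - hB.evalLp ⟨S.left i, (hS i).1, (S.le i).trans (hS i).2⟩),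
      Lp.coeFn_sub (hB.evalLp ⟨S.right i, (hS i).1.trans (S.le i), (hS i).2⟩)
        (hB.evalLp ⟨S.left i, (hS i).1, (S.le i).trans (hS i).2⟩),
      (hB.memLp_eval ⟨S.right i, (hS i).1.trans (S.le i), (hS i).2⟩).coeFn_toLp,
      (hB.memLp_eval ⟨S.left i, (hS i).1, (S.le i).trans (hS i).2⟩).coeFn_toLp] with ω h1 h2 h3 h4
    rw [h1, Pi.smul_apply, h2, Pi.sub_apply, IsBrownianOn.evalLp, IsBrownianOn.evalLp, h3, h4,
      smul_eq_mul]
  filter_upwards [h, Lp.coeFn_finsetSum (μ := P) (Finset.range S.n)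
    fun i => S.val i • (hB.evalLp ⟨S.right i, (hS i).1.trans (S.le i), (hS i).2⟩
        - hB.evalLp ⟨S.left i, (hS i).1, (S.le i).trans (hS i).2⟩)] with ω h1 h2
  rw [h2, Finset.sum_apply, Step.integral]
  exact Finset.sum_congr rfl h1

/-- On step functions the two integrals agree; continuity of `wiener` and uniqueness of `L²` limits
do the rest. In particular, `Y` does not depend on the approximating sequence. -/
theorem IsItoIntegral.ae_eq_wiener [IsProbabilityMeasure P] (hB : IsBrownianOn P 𝓕 T B)
    {t : ℝ} (ht : t ∈ Icc 0 T) {f : ℝ → ℝ} (hf : MemLp f 2 (volume.restrict (Icc (0 : ℝ) T)))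
    {Y : Ω → ℝ} (hY : IsItoIntegral P B t f Y) : Y =ᵐ[P] hB.wiener (windowLp hf t) := by
  obtain ⟨hYm, S, hS, hSf, hSY⟩ := hY
  have hS' : ∀ k i, 0 ≤ (S k).left i ∧ (S k).right i ≤ T := fun k i =>
    ⟨(hS k i).1, (hS k i).2.trans ht.2⟩
  have h1 : Tendsto (fun k => Finsupp.linearCombination ℝ (initialIndicator T)
      ((S k).combination (hS' k))) atTop (𝓝 (windowLp hf t)) := by
    refine Lp.tendsto_Lp_of_tendsto_eLpNorm _ _ (hSf.congr fun k => ?_)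
    -- Convergence in `L²([0, t])` lifts to `L²([0, T])` because the step functions vanish outside
    -- `[0, t]`.
    have hsub : Icc 0 t ⊆ Icc 0 T := Icc_subset_Icc_right ht.2
    rw [← inter_eq_self_of_subset_left hsub, ← Measure.restrict_restrict measurableSet_Icc,
      ← eLpNorm_indicator_eq_eLpNorm_restrict measurableSet_Icc]
    refine eLpNorm_congr_ae ?_
    filter_upwards [(S k).linearCombination_initialIndicator (hS' k)] with u hu
    rw [Pi.sub_apply, hu, inter_eq_self_of_subset_left hsub]
    by_cases hut : u ∈ Icc 0 t
    · rw [indicator_of_mem hut, indicator_of_mem hut]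
    · rw [indicator_of_notMem hut, indicator_of_notMem hut, sub_zero, Step.toFun]
      symm
      refine Finset.sum_eq_zero fun i _ => indicator_of_notMem (fun hi => hut ?_) _
      exact ⟨(hS k i).1.trans hi.1.le, hi.2.trans (hS k i).2⟩
  have h2 : Tendsto (fun k => Finsupp.linearCombination ℝ hB.evalLp
      ((S k).combination (hS' k))) atTop (𝓝 (hYm.toLp Y)) := by
    refine Lp.tendsto_Lp_of_tendsto_eLpNorm _ _ (hSY.congr fun k => ?_)
    refine eLpNorm_congr_ae ?_
    filter_upwards [(S k).linearCombination_evalLp hB (hS' k)] with ω hω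
    rw [Pi.sub_apply, hω]
  have h3 := (hB.wiener.continuous.tendsto _).comp h1
  have h4 : (hB.wiener ∘ fun k => Finsupp.linearCombination ℝ (initialIndicator T)
      ((S k).combination (hS' k))) = fun k => Finsupp.linearCombination ℝ hB.evalLp
      ((S k).combination (hS' k)) :=
    funext fun k => hB.wiener_linearCombination (ht.1.trans ht.2) _
  rw [h4] at h3
  rw [← tendsto_nhds_unique h2 h3]
  exact hYm.coeFn_toLp.symm

/-- A step function with one more term. -/
def Step.cons (S : Step) {a b : ℝ} (hab : a ≤ b) (c : ℝ) : Step where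
  n := S.n + 1
  left i := Nat.casesOn i a S.left
  right i := Nat.casesOn i b S.right
  val i := Nat.casesOn i c S.val
  le i := by cases i <;> simp [hab, S.le]

theorem Step.cons_toFun (S : Step) {a b : ℝ} (hab : a ≤ b) (c u : ℝ) :
    (S.cons hab c).toFun u = S.toFun u + (Ioc a b).indicator (fun _ => c) u := by
  simp [Step.toFun, Step.cons, Finset.sum_range_succ']

omit mΩ in
theorem Step.cons_integral (S : Step) {a b : ℝ} (hab : a ≤ b) (c : ℝ) (ω : Ω) :
    (S.cons hab c).integral B ω = S.integral B ω + c * (B b ω - B a ω) := by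
  simp [Step.integral, Step.cons, Finset.sum_range_succ']

/-- Each approximating step function gets one more term, cut off at `min t b` because its steps must
lie in `[0, t]`. -/
theorem IsItoIntegral.add_indicator (hB : IsBrownianOn P 𝓕 T B) {t : ℝ} (ht : t ∈ Icc 0 T)
    {f : ℝ → ℝ} {Y : Ω → ℝ} (hY : IsItoIntegral P B t f Y) {b : ℝ} (hb : 0 ≤ b) (c : ℝ) :
    IsItoIntegral P B t (fun u => f u + (Ioc 0 b).indicator (fun _ => c) u)
      (fun ω => Y ω + c * (B (min t b) ω - B 0 ω)) := by
  obtain ⟨hYm, S, hS, hSf, hSY⟩ := hY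
  have h0 : (0 : ℝ) ≤ min t b := le_min ht.1 hb
  refine ⟨?_, fun k => (S k).cons h0 c, ?_, ?_, ?_⟩
  · have h1 := hB.memLp_eval ⟨min t b, h0, (min_le_left _ _).trans ht.2⟩
    have h2 := hB.memLp_eval ⟨0, le_rfl, ht.1.trans ht.2⟩
    exact hYm.add ((h1.sub h2).const_mul c)
  · intro k i
    cases i with
    | zero => exact ⟨le_rfl, min_le_left _ _⟩
    | succ i => exact hS k i
  · refine hSf.congr fun k => eLpNorm_congr_ae ?_
    filter_upwards [ae_restrict_mem measurableSet_Icc] with u hu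
    have : (Ioc 0 (min t b)).indicator (fun _ => c) u = (Ioc 0 b).indicator (fun _ => c) u := by
      have := hu.2
      simp only [indicator_apply, mem_Ioc, le_min_iff, this, true_and]
    rw [Step.cons_toFun, this]
    ring
  · refine hSY.congr fun k => eLpNorm_congr_ae (ae_of_all _ fun ω => ?_)
    simp only [Step.cons_integral]
    ring

end Ito

/-! ### Path regularity and stochastic Fubini -/

section Fund

variable {P : Measure Ω} {𝓕 : Filtration ℝ mΩ} {T : ℝ} {B : ℝ → Ω → ℝ}

/-- On a complete filtered space, an adapted process with almost surely continuous paths has an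
adapted modification all of whose paths are continuous. -/
theorem exists_continuous_modification (h𝓕 : ∀ A : Set Ω, P A = 0 → MeasurableSet[𝓕 0] A)
    (hT : 0 ≤ T) {X : ℝ → Ω → ℝ} (hX : ∀ t ∈ Icc 0 T, Measurable[𝓕 t] (X t))
    (hc : ∀ᵐ ω ∂P, ContinuousOn (fun t => X t ω) (Icc 0 T)) :
    ∃ X' : ℝ → Ω → ℝ, (∀ ω, Continuous fun t => X' t ω) ∧
      (∀ t ∈ Icc 0 T, Measurable[𝓕 t] (X' t)) ∧ (∀ t, Measurable (X' t)) ∧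
      ∀ᵐ ω ∂P, ∀ t ∈ Icc 0 T, X' t ω = X t ω := by
  classical
  set N : Set Ω := {ω | ¬ContinuousOn (fun t => X t ω) (Icc 0 T)} with hN
  -- Completeness puts the bad null set into `𝓕 0`, so replacing the paths by `0` there preserves
  -- adaptedness. Good paths are frozen outside `[0, T]` by `projIcc`.
  have hN0 : MeasurableSet[𝓕 0] N := h𝓕 N hc
  have hm : ∀ t ∈ Icc 0 T, Measurable[𝓕 t] (fun ω => if ω ∈ N then 0 else X t ω) := by
    intro t ht
    exact Measurable.ite (𝓕.mono ht.1 _ hN0) measurable_const (hX t ht)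
  refine ⟨fun t ω => if ω ∈ N then 0 else X (projIcc 0 T hT t) ω, fun ω => ?_, fun t ht => ?_,
    fun t => ?_, ?_⟩
  · by_cases h : ω ∈ N
    · simp only [h, if_true]; exact continuous_const
    · simp only [h, if_false]
      have h' : ContinuousOn (fun t => X t ω) (Icc 0 T) := not_not.1 h
      exact h'.comp_continuous (continuous_subtype_val.comp continuous_projIcc)
        fun t => (projIcc 0 T hT t).2
  · simp only [projIcc_of_mem hT ht]
    exact hm t ht
  · exact (hm _ (projIcc 0 T hT t).2).mono (𝓕.le _) le_rfl
  · filter_upwards [hc] with ω hω t ht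
    have : ω ∉ N := not_not.2 hω
    simp only [this, if_false, projIcc_of_mem hT ht]

-- Path continuity upgrades measurability at each time to joint measurability. The σ-algebra `m` is
-- arbitrary so that `𝓕 t` can be used, and `projIcc` keeps the times in `[0, t]`.
omit mΩ in
theorem measurable_integral_of_continuous {m : MeasurableSpace Ω} {u : ℝ → Ω → ℝ} {t : ℝ}
    (ht : 0 ≤ t) (hc : ∀ ω, Continuous fun s => u s ω)
    (hm : ∀ s ∈ Icc 0 t, Measurable (u s)) :
    Measurable fun ω => ∫ s in (0 : ℝ)..t, u s ω := by
  have hj : Measurable (Function.uncurry fun (s : ℝ) ω => u (projIcc 0 t ht s) ω) :=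
    measurable_uncurry_of_continuous_of_measurable
      (fun ω => (hc ω).comp (continuous_subtype_val.comp continuous_projIcc))
      (fun s => hm _ (projIcc 0 t ht s).2)
  have h : (fun ω => ∫ s in (0 : ℝ)..t, u s ω)
      = fun ω => ∫ s in Ioc 0 t, u (projIcc 0 t ht s) ω := by
    funext ω
    rw [intervalIntegral.integral_of_le ht]
    refine setIntegral_congr_fun measurableSet_Ioc fun s hs => ?_
    simp only [projIcc_of_mem ht (Ioc_subset_Icc_self hs)]
  rw [h]
  exact (hj.comp measurable_swap).stronglyMeasurable.integral_prod_right'.measurable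

theorem memLp_continuous_mul {f φ : ℝ → ℝ} (hφ : Continuous φ)
    (hf : MemLp f 2 (volume.restrict (Icc (0 : ℝ) T))) :
    MemLp (fun u => φ u * f u) 2 (volume.restrict (Icc (0 : ℝ) T)) := by
  obtain ⟨K, hK⟩ := isCompact_Icc.exists_bound_of_continuousOn (s := Icc 0 T) hφ.continuousOn
  refine MemLp.of_le_mul (c := K) hf (hφ.aestronglyMeasurable.mul hf.1) ?_
  filter_upwards [ae_restrict_mem measurableSet_Icc] with u hu
  rw [norm_mul]
  exact mul_le_mul_of_nonneg_right (hK u hu) (norm_nonneg _)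

/-- Testing a stochastic integral on an event becomes a Lebesgue integral against one fixed `L²`
function, the adjoint applied to the indicator of the event. -/
theorem integral_restrict_wiener [IsProbabilityMeasure P] (hB : IsBrownianOn P 𝓕 T B)
    {A : Set Ω} (hA : MeasurableSet A) (h : Lp ℝ 2 (volume.restrict (Icc (0 : ℝ) T))) :
    ∫ ω in A, hB.wiener h ω ∂P = ∫ u in Icc 0 T,
      h u * (ContinuousLinearMap.adjoint hB.wiener
        (indicatorConstLp 2 hA (measure_ne_top P A) 1)) u := by
  rw [← L2.inner_indicatorConstLp_one hA (measure_ne_top P A),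
    ← ContinuousLinearMap.adjoint_inner_left, L2.inner_def]
  simp only [RCLike.inner_apply, conj_trivial]

/-- A stochastic Fubini theorem: the variation of constants formula for the Wiener integral. -/
theorem add_integral_exp_ae_eq_wiener [IsProbabilityMeasure P] (hB : IsBrownianOn P 𝓕 T B)
    (hT : 0 ≤ T) (r : ℝ) {f : ℝ → ℝ} (hf : MemLp f 2 (volume.restrict (Icc (0 : ℝ) T)))
    {R : ℝ → Ω → ℝ} (hRc : ∀ ω, Continuous fun t => R t ω) (hRm : ∀ t, Measurable (R t))
    (hR : ∀ t ∈ Icc 0 T, R t =ᵐ[P] hB.wiener (windowLp hf t)) :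
    (fun ω => R T ω + r * ∫ s in (0 : ℝ)..T, Real.exp (r * (T - s)) * R s ω) =ᵐ[P]
      hB.wiener ((memLp_continuous_mul (T := T) (φ := fun u => Real.exp (r * (T - u)))
        (by fun_prop) hf).toLp _) := by
  set W := hB.wiener
  have hLp : ∀ h : Lp ℝ 2 P, Integrable h P := fun h => (Lp.memLp h).integrable one_le_two
  have hRi : ∀ t ∈ Icc 0 T, Integrable (R t) P := fun t ht => (hLp _).congr (hR t ht).symm
  have hjoint : Measurable (Function.uncurry R) :=
    measurable_uncurry_of_continuous_of_measurable hRc hRm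
  have hgm : Measurable fun p : ℝ × Ω => Real.exp (r * (T - p.1)) * R p.1 p.2 :=
    Measurable.mul (by fun_prop) hjoint
  -- Fubini is justified by the bound `‖W‖ * ‖f‖` for the `L¹` norm of `R s`, uniform in `s`.
  have hint : Integrable (fun p : ℝ × Ω => Real.exp (r * (T - p.1)) * R p.1 p.2)
      ((volume.restrict (Ioc 0 T)).prod P) := by
    rw [integrable_prod_iff hgm.aestronglyMeasurable]
    refine ⟨?_, ?_⟩
    · filter_upwards [ae_restrict_mem measurableSet_Ioc] with s hs
      exact (hRi s (Ioc_subset_Icc_self hs)).const_mul _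
    · obtain ⟨K, hK⟩ := isCompact_Icc.exists_bound_of_continuousOn (s := Icc 0 T)
        (f := fun s => Real.exp (r * (T - s))) (by fun_prop)
      refine Integrable.of_bound (C := K * (‖W‖ * ‖hf.toLp f‖)) ?_ ?_
      · exact hgm.norm.stronglyMeasurable.integral_prod_right.aestronglyMeasurable
      · filter_upwards [ae_restrict_mem measurableSet_Ioc] with s hs
        have hs' := Ioc_subset_Icc_self hs
        rw [Real.norm_of_nonneg (integral_nonneg fun ω => norm_nonneg _)]
        simp only [norm_mul]
        rw [integral_const_mul]
        refine mul_le_mul (hK s hs') ?_ (integral_nonneg fun ω => norm_nonneg _)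
          ((norm_nonneg _).trans (hK s hs'))
        calc ∫ ω, ‖R s ω‖ ∂P = ∫ ω, ‖W (windowLp hf s) ω‖ ∂P :=
              integral_congr_ae ((hR s hs').fun_comp norm)
          _ ≤ ‖W (windowLp hf s)‖ := by
              rw [Lp.norm_def, integral_norm_eq_lintegral_enorm (Lp.aestronglyMeasurable _),
                ← eLpNorm_one_eq_lintegral_enorm]
              exact ENNReal.toReal_mono (Lp.eLpNorm_ne_top _)
                (eLpNorm_le_eLpNorm_of_exponent_le one_le_two (Lp.aestronglyMeasurable _))
          _ ≤ ‖W‖ * ‖windowLp hf s‖ := W.le_opNorm _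
          _ ≤ _ := mul_le_mul_of_nonneg_left (norm_windowLp_le hf s) (norm_nonneg _)
  have hVi : Integrable (fun ω => R T ω + r * ∫ s in (0 : ℝ)..T, Real.exp (r * (T - s)) * R s ω)
      P := by
    refine (hRi T (right_mem_Icc.2 hT)).add (Integrable.const_mul ?_ r)
    simp only [intervalIntegral.integral_of_le hT]
    exact hint.integral_prod_right
  -- After testing on `A`, the identity becomes `integral_exp_mul_primitive` for the deterministic
  -- function `f * k`.
  refine Integrable.ae_eq_of_forall_setIntegral_eq _ _ hVi (hLp _) fun A hA _ => ?_
  set k := ContinuousLinearMap.adjoint W (indicatorConstLp 2 hA (measure_ne_top P A) 1) with hk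
  have hfk : IntegrableOn (fun u => f u * k u) (Icc 0 T) :=
    hf.integrable_mul (Lp.memLp k)
  have hfki : IntervalIntegrable (fun u => f u * k u) volume 0 T :=
    (intervalIntegrable_iff_integrableOn_Icc_of_le hT).2 hfk
  have hAR : ∀ t ∈ Icc 0 T, ∫ ω in A, R t ω ∂P = ∫ u in (0 : ℝ)..t, f u * k u := by
    intro t ht
    have hsub : Icc 0 t ⊆ Icc 0 T := Icc_subset_Icc_right ht.2
    have hset : ∫ u in (0 : ℝ)..t, f u * k u
        = ∫ u in Icc 0 T, (Icc 0 t).indicator (fun u => f u * k u) u := by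
      rw [setIntegral_indicator measurableSet_Icc, inter_eq_self_of_subset_right hsub,
        intervalIntegral.integral_of_le ht.1, integral_Icc_eq_integral_Ioc]
    rw [integral_congr_ae (ae_restrict_of_ae (hR t ht)), integral_restrict_wiener hB hA, hset]
    refine integral_congr_ae ?_
    filter_upwards [windowLp_coeFn hf t] with u hu
    rw [hu, indicator_mul_left]
  have hUA : ∫ ω in A, (∫ s in (0 : ℝ)..T, Real.exp (r * (T - s)) * R s ω) ∂P
      = ∫ s in (0 : ℝ)..T, Real.exp (r * (T - s)) * ∫ u in (0 : ℝ)..s, f u * k u := by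
    have hint' : Integrable (Function.uncurry fun (s : ℝ) ω => Real.exp (r * (T - s)) * R s ω)
        ((volume.restrict (Ioc 0 T)).prod (P.restrict A)) := by
      refine hint.mono_measure ?_
      exact Measure.prod_mono le_rfl Measure.restrict_le_self
    simp only [intervalIntegral.integral_of_le hT]
    rw [← integral_integral_swap hint']
    refine setIntegral_congr_fun measurableSet_Ioc fun s hs => ?_
    simp only [integral_const_mul, hAR s (Ioc_subset_Icc_self hs)]
  have hUi : Integrable (fun ω => ∫ s in (0 : ℝ)..T, Real.exp (r * (T - s)) * R s ω) P := by
    simp only [intervalIntegral.integral_of_le hT]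
    exact hint.integral_prod_right
  rw [integral_add (hRi T (right_mem_Icc.2 hT)).integrableOn (hUi.const_mul r).integrableOn,
    integral_const_mul, hUA, hAR T (right_mem_Icc.2 hT), integral_exp_mul_primitive r hfki,
    integral_restrict_wiener hB hA, integral_Icc_eq_integral_Ioc,
    ← intervalIntegral.integral_of_le hT, ← intervalIntegral.integral_add hfki
      (hfki.continuousOn_mul (by fun_prop))]
  refine intervalIntegral.integral_congr_ae_restrict ?_
  rw [uIoc_of_le hT]
  have := (memLp_continuous_mul (T := T) (φ := fun u => Real.exp (r * (T - u)))
    (by fun_prop) hf).coeFn_toLp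
  filter_upwards [ae_restrict_of_ae_restrict_of_subset Ioc_subset_Icc_self this] with u hu
  rw [hu]
  ring

end Fund

/-! ### The law of the terminal fund and the perturbed funds -/

theorem mul_integral_exp (r T : ℝ) :
    r * ∫ s in (0 : ℝ)..T, Real.exp (r * (T - s)) = Real.exp (r * T) - 1 := by
  rw [← intervalIntegral.integral_const_mul]
  have hd : ∀ s, HasDerivAt (fun s => -Real.exp (r * (T - s))) (r * Real.exp (r * (T - s))) s :=
    fun s => by
      refine ((((hasDerivAt_id s).const_sub T).const_mul r).exp.neg).congr_deriv ?_
      simp only [id]; ring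
  rw [intervalIntegral.integral_eq_sub_of_hasDerivAt (fun s _ => hd s)
    (Continuous.intervalIntegrable (by fun_prop) _ _)]
  simp
  ring

/-- The mean of the terminal fund under the decisions `I`, `C`. -/
def terminalMean (M : Market) (x : ℝ) (I C : ℝ → ℝ) : ℝ :=
  Real.exp (M.r * M.T) * x
    + ∫ u in (0 : ℝ)..M.T, Real.exp (M.r * (M.T - u)) * (M.v * I u - C u)

/-- The variance of the terminal fund under the investment decision `I`, divided by `σ²`. -/
def terminalVariance (M : Market) (I : ℝ → ℝ) : ℝ :=
  ∫ u in (0 : ℝ)..M.T, (Real.exp (M.r * (M.T - u)) * I u) ^ 2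

section Fund

variable {P : Measure Ω} {𝓕 : Filtration ℝ mΩ} {M : Market} {B : ℝ → Ω → ℝ} {x : ℝ}
  {I C : ℝ → ℝ} {X : ℝ → Ω → ℝ}

theorem IsDecision.integrableOn_investment {T : ℝ} (hD : IsDecision T I C) :
    IntegrableOn I (Icc 0 T) :=
  hD.investment.integrable one_le_two

theorem IsDecision.intervalIntegrable_investment {T t : ℝ} (hD : IsDecision T I C)
    (ht : t ∈ Icc 0 T) : IntervalIntegrable I volume 0 t :=
  (intervalIntegrable_iff_integrableOn_Icc_of_le ht.1).2
    (hD.integrableOn_investment.mono_set (Icc_subset_Icc_right ht.2))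

theorem IsDecision.intervalIntegrable_consumption {T t : ℝ} (hD : IsDecision T I C)
    (ht : t ∈ Icc 0 T) : IntervalIntegrable C volume 0 t :=
  (intervalIntegrable_iff_integrableOn_Icc_of_le ht.1).2
    (hD.consumption.mono_set (Icc_subset_Icc_right ht.2))

/-- Variation of constants is applied pathwise to the fund equation; the drift yields the mean, and
the stochastic Fubini theorem turns the noise into one Wiener integral. -/
theorem IsFundProcess.terminal_ae_eq [IsProbabilityMeasure P]
    (h𝓕 : ∀ A : Set Ω, P A = 0 → MeasurableSet[𝓕 0] A) (hB : IsBrownianOn P 𝓕 M.T B)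
    (hT : 0 ≤ M.T) (hσ : 0 < M.σ) (hD : IsDecision M.T I C)
    (hX : IsFundProcess P 𝓕 B M x I C X) :
    X M.T =ᵐ[P] fun ω => terminalMean M x I C + M.σ * hB.wiener
      ((memLp_continuous_mul (T := M.T) (φ := fun u => Real.exp (M.r * (M.T - u)))
        (by fun_prop) hD.investment).toLp _) ω := by
  obtain ⟨X', hX'c, -, hX'm, hX'X⟩ :=
    exists_continuous_modification h𝓕 hT hX.adapted hX.continuous_paths
  set k : ℝ → ℝ := (Icc 0 M.T).indicator fun u => M.v * I u - C u with hk
  have hki : Integrable k := by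
    rw [hk, integrable_indicator_iff measurableSet_Icc]
    exact (hD.integrableOn_investment.const_mul M.v).sub hD.consumption
  have hkeq : ∀ t ∈ Icc 0 M.T, ∫ u in (0 : ℝ)..t, k u = ∫ u in (0 : ℝ)..t, (M.v * I u - C u) := by
    intro t ht
    refine intervalIntegral.integral_congr fun u hu => ?_
    rw [uIcc_of_le ht.1] at hu
    exact indicator_of_mem (Icc_subset_Icc_right ht.2 hu) _
  set d : ℝ → ℝ := fun t => x + ∫ u in (0 : ℝ)..t, k u with hd
  have hdc : Continuous d := continuous_const.add
    (intervalIntegral.continuous_primitive (fun _ _ => hki.intervalIntegrable) 0)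
  -- The noise is recovered from the fund itself: the Itô integrals in the equation are chosen
  -- separately for each `t` and need not have continuous paths, whereas `R` does.
  set R : ℝ → Ω → ℝ := fun t ω => M.σ⁻¹ * (X' t ω - M.r * (∫ s in (0 : ℝ)..t, X' s ω) - d t)
    with hRdef
  have hprim : ∀ ω, Continuous fun t => ∫ s in (0 : ℝ)..t, X' s ω := fun ω =>
    intervalIntegral.continuous_primitive (fun _ _ => (hX'c ω).intervalIntegrable _ _) 0
  have hRc : ∀ ω, Continuous fun t => R t ω := fun ω =>
    continuous_const.mul (((hX'c ω).sub ((hprim ω).const_mul _)).sub hdc)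
  have hjoint : Measurable (Function.uncurry X') :=
    measurable_uncurry_of_continuous_of_measurable hX'c hX'm
  have hRm : ∀ t, Measurable (R t) := by
    intro t
    refine Measurable.const_mul (((hX'm t).sub (Measurable.const_mul ?_ _)).sub
      measurable_const) _
    simp only [intervalIntegral]
    exact ((hjoint.comp measurable_swap).stronglyMeasurable.integral_prod_right'.sub
      (hjoint.comp measurable_swap).stronglyMeasurable.integral_prod_right').measurable
  have hR : ∀ t ∈ Icc 0 M.T, R t =ᵐ[P] hB.wiener (windowLp hD.investment t) := by
    intro t ht
    obtain ⟨Y, hY, hXY⟩ := hX.equation t ht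
    refine EventuallyEq.trans ?_ (hY.ae_eq_wiener hB ht hD.investment)
    filter_upwards [hXY, hX'X] with ω h1 h2
    have h3 : ∫ s in (0 : ℝ)..t, (M.r * X s ω + M.v * I s - C s)
        = M.r * (∫ s in (0 : ℝ)..t, X' s ω) + ∫ s in (0 : ℝ)..t, (M.v * I s - C s) := by
      rw [← intervalIntegral.integral_const_mul, ← intervalIntegral.integral_add]
      · refine intervalIntegral.integral_congr fun s hs => ?_
        rw [uIcc_of_le ht.1] at hs
        simp only [h2 s (Icc_subset_Icc_right ht.2 hs)]
        ring
      · exact ((hX'c ω).intervalIntegrable _ _).const_mul _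
      · exact ((hD.intervalIntegrable_investment ht).const_mul _).sub
          (hD.intervalIntegrable_consumption ht)
    simp only [hRdef, hd, h2 t ht, h1, h3, hkeq t ht]
    field_simp
    ring
  filter_upwards [hX'X, add_integral_exp_ae_eq_wiener hB hT M.r hD.investment hRc hRm hR]
    with ω h1 h2
  have hTm : M.T ∈ Icc 0 M.T := right_mem_Icc.2 hT
  have h3 := eq_add_integral_exp (q := fun t => X' t ω)
    (n := fun t => M.σ * R t ω + (x + ∫ u in (0 : ℝ)..t, k u)) M.r hT (hX'c ω).continuousOn
    (fun s _ => by simp only [hRdef, hd]; field_simp; ring)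
  have hce : Continuous fun s => Real.exp (M.r * (M.T - s)) := by fun_prop
  have hp : Continuous fun t => ∫ u in (0 : ℝ)..t, k u :=
    intervalIntegral.continuous_primitive (fun _ _ => hki.intervalIntegrable) 0
  have h4 : ∫ s in (0 : ℝ)..M.T, Real.exp (M.r * (M.T - s))
        * (M.σ * R s ω + (x + ∫ u in (0 : ℝ)..s, k u))
      = M.σ * (∫ s in (0 : ℝ)..M.T, Real.exp (M.r * (M.T - s)) * R s ω)
        + (x * (∫ s in (0 : ℝ)..M.T, Real.exp (M.r * (M.T - s)))
        + ∫ s in (0 : ℝ)..M.T, Real.exp (M.r * (M.T - s)) * ∫ u in (0 : ℝ)..s, k u) := by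
    rw [← intervalIntegral.integral_const_mul, ← intervalIntegral.integral_const_mul,
      ← intervalIntegral.integral_add, ← intervalIntegral.integral_add]
    · congr 1 with s; ring
    · exact ((hce.mul (hRc ω)).const_mul _).intervalIntegrable _ _
    · exact ((hce.const_mul _).add (hce.mul hp)).intervalIntegrable _ _
    · exact (hce.const_mul _).intervalIntegrable _ _
    · exact (hce.mul hp).intervalIntegrable _ _
  have h5 := integral_exp_mul_primitive M.r (hki.intervalIntegrable (a := 0) (b := M.T))
  have h6 := mul_integral_exp M.r M.T
  have h7 : ∫ u in (0 : ℝ)..M.T, (Real.exp (M.r * (M.T - u)) - 1) * k u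
      = (∫ u in (0 : ℝ)..M.T, Real.exp (M.r * (M.T - u)) * (M.v * I u - C u))
        - ∫ u in (0 : ℝ)..M.T, k u := by
    rw [← intervalIntegral.integral_sub]
    · refine intervalIntegral.integral_congr fun u hu => ?_
      rw [uIcc_of_le hT] at hu
      simp only [hk, indicator_of_mem hu]
      ring
    · exact (((hD.intervalIntegrable_investment hTm).const_mul _).sub
        (hD.intervalIntegrable_consumption hTm)).continuousOn_mul hce.continuousOn
    · exact hki.intervalIntegrable
  rw [← h1 M.T hTm, ← h2, terminalMean]
  rw [h4] at h3
  rw [h7] at h5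
  linear_combination h3 + h5 + x * h6

/-- Exponential utility of a Gaussian variable is a Laplace transform, here at `-α σ`. From here on
the objective is deterministic. -/
theorem IsFundProcess.integral_fundUtility [IsProbabilityMeasure P]
    (h𝓕 : ∀ A : Set Ω, P A = 0 → MeasurableSet[𝓕 0] A) (hB : IsBrownianOn P 𝓕 M.T B)
    (hT : 0 ≤ M.T) (hσ : 0 < M.σ) (hD : IsDecision M.T I C)
    (hX : IsFundProcess P 𝓕 B M x I C X) (H : Household) :
    ∫ ω, fundUtility H (X M.T ω) ∂P = -(1 / H.α) * Real.exp (-H.α * terminalMean M x I C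
      + H.α ^ 2 * M.σ ^ 2 / 2 * terminalVariance M I) := by
  set f := (memLp_continuous_mul (T := M.T) (φ := fun u => Real.exp (M.r * (M.T - u)))
        (by fun_prop) hD.investment).toLp _ with hf
  have h1 : ∫ ω, fundUtility H (X M.T ω) ∂P
      = ∫ ω, (-(1 / H.α) * Real.exp (-H.α * terminalMean M x I C))
        * Real.exp (-(H.α * M.σ) * hB.wiener f ω) ∂P := by
    refine integral_congr_ae ?_
    filter_upwards [hX.terminal_ae_eq h𝓕 hB hT hσ hD] with ω hω
    rw [fundUtility, hω, mul_assoc, ← Real.exp_add]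
    congr 2
    ring
  have h2 : ‖f‖ ^ 2 = terminalVariance M I := by
    rw [← real_inner_self_eq_norm_sq, L2.inner_def, terminalVariance,
      intervalIntegral.integral_of_le hT, ← integral_Icc_eq_integral_Ioc]
    refine integral_congr_ae ?_
    filter_upwards [MemLp.coeFn_toLp (memLp_continuous_mul (T := M.T)
      (φ := fun u => Real.exp (M.r * (M.T - u))) (by fun_prop) hD.investment)] with u hu
    rw [hf, hu]
    simp only [RCLike.inner_apply, conj_trivial, pow_two]
  rw [h1, integral_const_mul, hB.integral_exp_wiener hT, h2, mul_assoc, ← Real.exp_add]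
  congr 3
  ring

/-- The equation is linear, so it suffices to add to `X` a solution `Z` of `Z = n + r ∫ Z`, which is
explicit. Indicator perturbations of `I` keep the added noise an increment of `B`. -/
theorem IsFundProcess.exists_perturbation [IsProbabilityMeasure P]
    (h𝓕 : ∀ A : Set Ω, P A = 0 → MeasurableSet[𝓕 0] A) (hB : IsBrownianOn P 𝓕 M.T B)
    (hT : 0 ≤ M.T) (hD : IsDecision M.T I C) (hX : IsFundProcess P 𝓕 B M x I C X)
    {b : ℝ} (hb : 0 ≤ b) (δ : ℝ) {k : ℝ → ℝ} (hk : Integrable k) :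
    ∃ X' : ℝ → Ω → ℝ, IsFundProcess P 𝓕 B M x
      (fun u => I u + (Ioc 0 b).indicator (fun _ => δ) u) (fun u => C u + k u) X' := by
  -- Continuity of every path, not just almost every one, is used for the adaptedness of the time
  -- integral in `Z`.
  obtain ⟨B', hB'c, hB'a, -, hB'B⟩ :=
    exists_continuous_modification h𝓕 hT hB.adapted hB.continuous_paths
  have hind : Integrable ((Ioc 0 b).indicator fun _ : ℝ => δ) := by
    rw [integrable_indicator_iff measurableSet_Ioc]
    exact integrableOn_const (by simp)
  set h : ℝ → ℝ := fun u => M.v * (Ioc 0 b).indicator (fun _ => δ) u - k u with hh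
  have hhi : Integrable h := (hind.const_mul M.v).sub hk
  set n : ℝ → Ω → ℝ := fun t ω =>
    (∫ u in (0 : ℝ)..t, h u) + M.σ * (δ * (B' (min t b) ω - B' 0 ω)) with hn
  have hnc : ∀ ω, Continuous fun t => n t ω := fun ω =>
    (intervalIntegral.continuous_primitive (fun _ _ => hhi.intervalIntegrable) 0).add
      (continuous_const.mul (continuous_const.mul
        (((hB'c ω).comp (continuous_id.min continuous_const)).sub continuous_const)))
  have hna : ∀ t ∈ Icc 0 M.T, Measurable[𝓕 t] (n t) := by
    intro t ht
    have h1 : Measurable[𝓕 t] (B' (min t b)) :=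
      (hB'a _ ⟨le_min ht.1 hb, (min_le_left _ _).trans ht.2⟩).mono (𝓕.mono (min_le_left _ _)) le_rfl
    have h2 : Measurable[𝓕 t] (B' 0) := (hB'a 0 ⟨le_rfl, hT⟩).mono (𝓕.mono ht.1) le_rfl
    exact measurable_const.add (((h1.sub h2).const_mul δ).const_mul M.σ)
  set Z : ℝ → Ω → ℝ := fun t ω => n t ω + M.r * (Real.exp (M.r * t)
    * ∫ u in (0 : ℝ)..t, Real.exp (-M.r * u) * n u ω) with hZ
  have hZc : ∀ ω, Continuous fun t => Z t ω := fun ω => by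
    have h1 : Continuous fun t => ∫ u in (0 : ℝ)..t, Real.exp (-M.r * u) * n u ω :=
      intervalIntegral.continuous_primitive (fun _ _ => Continuous.intervalIntegrable
        (Continuous.mul (by fun_prop) (hnc ω)) _ _) 0
    exact (hnc ω).add (continuous_const.mul (Continuous.mul (by fun_prop) h1))
  have hZa : ∀ t ∈ Icc 0 M.T, Measurable[𝓕 t] (Z t) := by
    intro t ht
    refine (hna t ht).add (Measurable.const_mul (Measurable.const_mul ?_ _) _)
    refine measurable_integral_of_continuous (m := 𝓕 t) ht.1
      (fun ω => Continuous.mul (by fun_prop) (hnc ω)) fun s hs => ?_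
    exact ((hna s ⟨hs.1, hs.2.trans ht.2⟩).mono (𝓕.mono hs.2) le_rfl).const_mul _
  have hZeq : ∀ t ω, Z t ω = n t ω + M.r * ∫ s in (0 : ℝ)..t, Z s ω := fun t ω => by
    simp only [hZ]
    rw [integral_add_integral_exp M.r t (hnc ω)]
  refine ⟨fun t ω => X t ω + Z t ω, ⟨fun t ht => (hX.adapted t ht).add (hZa t ht), ?_, ?_, ?_⟩⟩
  · filter_upwards [hX.continuous_paths] with ω hω
    exact hω.add (hZc ω).continuousOn
  · filter_upwards [hX.start] with ω hω
    simp [hω, hZ, hn, hb]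
  · intro t ht
    obtain ⟨Y, hY, hXY⟩ := hX.equation t ht
    refine ⟨_, hY.add_indicator hB ht hb δ, ?_⟩
    filter_upwards [hXY, hB'B, hX.continuous_paths] with ω h1 h2 h3
    have hXi : IntervalIntegrable (fun s => X s ω) volume 0 t :=
      (h3.mono (Icc_subset_Icc_right ht.2)).intervalIntegrable_of_Icc ht.1
    have hZi : IntervalIntegrable (fun s => Z s ω) volume 0 t := (hZc ω).intervalIntegrable _ _
    have h4 : ∫ s in (0 : ℝ)..t, (M.r * (X s ω + Z s ω)
          + M.v * (I s + (Ioc 0 b).indicator (fun _ => δ) s) - (C s + k s))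
        = (∫ s in (0 : ℝ)..t, (M.r * X s ω + M.v * I s - C s))
          + ((∫ s in (0 : ℝ)..t, h s) + M.r * ∫ s in (0 : ℝ)..t, Z s ω) := by
      rw [← intervalIntegral.integral_const_mul, ← intervalIntegral.integral_add,
        ← intervalIntegral.integral_add]
      · congr 1 with s
        simp only [hh]
        ring
      · exact ((hXi.const_mul _).add ((hD.intervalIntegrable_investment ht).const_mul _)).sub
          (hD.intervalIntegrable_consumption ht)
      · exact hhi.intervalIntegrable.add (hZi.const_mul _)
      · exact hhi.intervalIntegrable
      · exact hZi.const_mul _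
    rw [h4, h1, hZeq t ω]
    have h5 := h2 (min t b) ⟨le_min ht.1 hb, (min_le_left _ _).trans ht.2⟩
    have h6 := h2 0 ⟨le_rfl, hT⟩
    simp only [hn, h5, h6]
    ring

end Fund

/-! ### First order conditions -/

/-- The logarithm of the expected marginal fund utility under the decisions `I`, `C`. -/
def logMarginal (M : Market) (H : Household) (I C : ℝ → ℝ) : ℝ :=
  -H.α * terminalMean M H.x I C + H.α ^ 2 * M.σ ^ 2 / 2 * terminalVariance M I

section Optimality

variable {P : Measure Ω} {𝓕 : Filtration ℝ mΩ} {M : Market} {B : ℝ → Ω → ℝ} {H : Household}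
  {I C : ℝ → ℝ} {X : ℝ → Ω → ℝ}

theorem IsDecision.integrableOn_exp {T : ℝ} (hD : IsDecision T I C) {β : ℝ} (hβ : 0 ≤ β) (ρ : ℝ) :
    IntegrableOn (fun t => Real.exp (-ρ * t - β * C t)) (Icc 0 T) := by
  have hC : AEMeasurable C (volume.restrict (Icc 0 T)) := hD.consumption.aemeasurable
  obtain ⟨K, hK⟩ := isCompact_Icc.exists_bound_of_continuousOn (s := Icc 0 T)
    (f := fun t => Real.exp (-ρ * t)) (by fun_prop)
  refine IntegrableOn.of_bound (C := K) measure_Icc_lt_top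
    (AEMeasurable.aestronglyMeasurable (by fun_prop)) ?_
  filter_upwards [ae_restrict_mem measurableSet_Icc] with t ht
  refine le_trans ?_ (hK t ht)
  rw [Real.norm_of_nonneg (Real.exp_pos _).le, Real.norm_of_nonneg (Real.exp_pos _).le]
  exact Real.exp_le_exp.2 (by nlinarith [hD.consumption_pos t ht])

/-- The first order condition for consumption. -/
theorem consumption_foc [IsProbabilityMeasure P]
    (h𝓕 : ∀ A : Set Ω, P A = 0 → MeasurableSet[𝓕 0] A) (hB : IsBrownianOn P 𝓕 M.T B)
    (hT : 0 ≤ M.T) (hσ : 0 < M.σ) (hα : 0 < H.α) (hβ : 0 < H.β)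
    (hD : IsDecision M.T I C) (hX : IsFundProcess P 𝓕 B M H.x I C X)
    (hopt : ∀ (C₀ : ℝ → ℝ) (X₀ : ℝ → Ω → ℝ), IsDecision M.T I C₀ →
      IsFundProcess P 𝓕 B M H.x I C₀ X₀ →
      rationalObjective P M H C₀ X₀ ≤ rationalObjective P M H C X) :
    ∀ᵐ t ∂(volume.restrict (Icc 0 M.T)),
      H.γ * Real.exp (-M.ρ * M.r * t - H.β * C t)
        = Real.exp (logMarginal M H I C) * Real.exp (M.r * (M.T - t)) := by
  set L := logMarginal M H I C with hL
  set g : ℝ → ℝ := fun t => Real.exp L * Real.exp (M.r * (M.T - t))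
    - H.γ * Real.exp (-M.ρ * M.r * t - H.β * C t) with hg
  have hTm : M.T ∈ Icc 0 M.T := right_mem_Icc.2 hT
  have hei : IntegrableOn (fun t => Real.exp (M.r * (M.T - t))) (Icc 0 M.T) :=
    Continuous.integrableOn_Icc (by fun_prop)
  have hui : IntegrableOn (fun t => Real.exp (-M.ρ * M.r * t - H.β * C t)) (Icc 0 M.T) := by
    have := hD.integrableOn_exp hβ.le (M.ρ * M.r)
    simpa only [neg_mul] using this
  have hgi : IntegrableOn g (Icc 0 M.T) := (hei.const_mul _).sub (hui.const_mul _)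
  -- Consumption is varied only where it exceeds `δ`, so that it stays positive for perturbations of
  -- both signs.
  have key : ∀ A : Set ℝ, MeasurableSet A → A ⊆ Icc 0 M.T → ∀ δ > 0, (∀ t ∈ A, δ < C t) →
      ∫ t in A, g t = 0 := by
    intro A hA hAT δ hδ hAC
    set a := ∫ t in A, Real.exp (M.r * (M.T - t)) with ha
    set u := ∫ t in A, Real.exp (-M.ρ * M.r * t - H.β * C t) with hu
    set U := ∫ t in (0 : ℝ)..M.T, consumptionUtility M H t (C t) with hU
    have hcv : ∀ f : ℝ → ℝ, ∫ t in (0 : ℝ)..M.T, A.indicator f t = ∫ t in A, f t := fun f => by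
      rw [intervalIntegral.integral_of_le hT, ← integral_Icc_eq_integral_Ioc,
        setIntegral_indicator hA, inter_eq_self_of_subset_right hAT]
    -- The objective at `C + ε 1_A`, in closed form.
    set φ : ℝ → ℝ := fun ε => -(1 / H.α) * Real.exp (L + H.α * ε * a)
      + H.γ * (U - (Real.exp (-H.β * ε) - 1) / H.β * u) with hφ
    have hkint : ∀ ε : ℝ, Integrable (A.indicator fun _ => ε) := fun ε => by
      rw [integrable_indicator_iff hA]
      exact integrableOn_const (((measure_mono hAT).trans_lt measure_Icc_lt_top).ne)
    have hmax : IsLocalMax φ 0 := by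
      filter_upwards [Ioo_mem_nhds (neg_lt_zero.2 hδ) hδ] with ε hε
      have hD' : IsDecision M.T I (fun t => C t + A.indicator (fun _ => ε) t) := by
        refine ⟨hD.investment, hD.consumption.add (hkint ε).integrableOn, fun t ht => ?_⟩
        by_cases htA : t ∈ A
        · rw [indicator_of_mem htA]
          linarith [hAC t htA, hε.1]
        · rw [indicator_of_notMem htA, add_zero]
          exact hD.consumption_pos t ht
      -- With `b = 0` and `δ = 0` the investment is unchanged.
      obtain ⟨X', hX'⟩ := hX.exists_perturbation h𝓕 hB hT hD le_rfl 0 (hkint ε)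
      simp only [indicator_zero, add_zero] at hX'
      have hle := hopt _ X' hD' hX'
      have hmean : terminalMean M H.x I (fun t => C t + A.indicator (fun _ => ε) t)
          = terminalMean M H.x I C - ε * a := by
        have : ∀ t, Real.exp (M.r * (M.T - t)) * (M.v * I t - (C t + A.indicator (fun _ => ε) t))
            = Real.exp (M.r * (M.T - t)) * (M.v * I t - C t)
              - ε * A.indicator (fun t => Real.exp (M.r * (M.T - t))) t := fun t => by
          by_cases htA : t ∈ A
          · simp only [indicator_of_mem htA]; ring
          · simp only [indicator_of_notMem htA]; ring
        simp only [terminalMean, this]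
        rw [intervalIntegral.integral_sub, intervalIntegral.integral_const_mul, hcv]
        · ring
        · exact (((hD.intervalIntegrable_investment hTm).const_mul _).sub
            (hD.intervalIntegrable_consumption hTm)).continuousOn_mul (by fun_prop)
        · rw [intervalIntegrable_iff_integrableOn_Icc_of_le hT]
          exact (hei.indicator hA).const_mul ε
      have hutil : ∫ t in (0 : ℝ)..M.T,
          consumptionUtility M H t (C t + A.indicator (fun _ => ε) t)
          = U - (Real.exp (-H.β * ε) - 1) / H.β * u := by
        have : ∀ t, consumptionUtility M H t (C t + A.indicator (fun _ => ε) t)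
            = consumptionUtility M H t (C t) - (Real.exp (-H.β * ε) - 1) / H.β
              * A.indicator (fun t => Real.exp (-M.ρ * M.r * t - H.β * C t)) t := fun t => by
          by_cases htA : t ∈ A
          · simp only [indicator_of_mem htA, consumptionUtility]
            rw [show -M.ρ * M.r * t - H.β * (C t + ε)
              = -M.ρ * M.r * t - H.β * C t + -H.β * ε by ring, Real.exp_add]
            field_simp
            ring
          · simp only [indicator_of_notMem htA, add_zero, mul_zero, sub_zero]
        simp only [this]
        rw [intervalIntegral.integral_sub, intervalIntegral.integral_const_mul, hcv]
        · rw [intervalIntegrable_iff_integrableOn_Icc_of_le hT]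
          exact hui.const_mul _
        · rw [intervalIntegrable_iff_integrableOn_Icc_of_le hT]
          exact (hui.indicator hA).const_mul _
      simp only [rationalObjective] at hle
      rw [hX'.integral_fundUtility h𝓕 hB hT hσ hD', hX.integral_fundUtility h𝓕 hB hT hσ hD,
        hmean, hutil] at hle
      have e1 : -H.α * (terminalMean M H.x I C - ε * a)
          + H.α ^ 2 * M.σ ^ 2 / 2 * terminalVariance M I = L + H.α * ε * a := by
        rw [hL, logMarginal]; ring
      rw [e1] at hle
      simp only [hφ, mul_zero, zero_mul, add_zero, Real.exp_zero, sub_self, zero_div, sub_zero]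
      exact hle
    have hder : HasDerivAt φ (-(1 / H.α) * (Real.exp (L + H.α * 0 * a) * (H.α * 1 * a))
        + H.γ * (0 - Real.exp (-H.β * 0) * (-H.β * 1) / H.β * u)) 0 := by
      refine HasDerivAt.add (HasDerivAt.const_mul _ (HasDerivAt.exp ?_)) (HasDerivAt.const_mul _ ?_)
      · exact (((hasDerivAt_id (0 : ℝ)).const_mul H.α).mul_const a).const_add L
      · exact (hasDerivAt_const _ U).sub
          ((((((hasDerivAt_id (0 : ℝ)).const_mul (-H.β)).exp).sub_const 1).div_const H.β).mul_const u)
    have h0 := hmax.hasDerivAt_eq_zero hder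
    have hga : ∫ t in A, g t = Real.exp L * a - H.γ * u := by
      simp only [hg]
      rw [integral_sub ((hei.mono_set hAT).const_mul _) ((hui.mono_set hAT).const_mul _),
        integral_const_mul, integral_const_mul]
    rw [hga]
    simp only [mul_zero, zero_mul, add_zero, Real.exp_zero] at h0
    field_simp at h0
    linarith
  -- As `C` is only almost everywhere measurable, its superlevel sets are replaced by measurable
  -- subsets. By positivity of `C` they exhaust `[0, T]` up to a null set.
  have hn : ∀ n : ℕ, ∃ D : Set ℝ, D ⊆ {t | 1 / ((n : ℝ) + 1) < C t} ∧ MeasurableSet D ∧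
      D =ᵐ[volume.restrict (Icc 0 M.T)] {t | 1 / ((n : ℝ) + 1) < C t} := fun n =>
    (nullMeasurableSet_lt aemeasurable_const
      hD.consumption.aemeasurable).exists_measurable_subset_ae_eq
  choose D hDs hDm hDe using hn
  have hzero : ∀ n, ∀ᵐ t ∂(volume.restrict (Icc 0 M.T)), t ∈ D n → g t = 0 := by
    intro n
    rw [← ae_restrict_iff' (hDm n), Measure.restrict_restrict (hDm n)]
    refine Integrable.ae_eq_of_forall_setIntegral_eq g 0
      (hgi.mono_set inter_subset_right) (integrable_zero _ _ _) fun s hs _ => ?_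
    rw [Measure.restrict_restrict hs, key (s ∩ (D n ∩ Icc 0 M.T))
      (hs.inter ((hDm n).inter measurableSet_Icc))
      (inter_subset_right.trans inter_subset_right) (1 / ((n : ℝ) + 1)) (by positivity)
      (fun t ht => hDs n ht.2.1)]
    simp
  filter_upwards [ae_all_iff.2 hzero, ae_all_iff.2 hDe, ae_restrict_mem measurableSet_Icc]
    with t h1 h2 ht
  obtain ⟨n, hn⟩ := exists_nat_one_div_lt (hD.consumption_pos t ht)
  have h3 := h1 n ((h2 n).mpr hn)
  simp only [hg] at h3
  linarith

/-- The first order condition for investment. -/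
theorem investment_foc [IsProbabilityMeasure P]
    (h𝓕 : ∀ A : Set Ω, P A = 0 → MeasurableSet[𝓕 0] A) (hB : IsBrownianOn P 𝓕 M.T B)
    (hT : 0 ≤ M.T) (hσ : 0 < M.σ) (hα : 0 < H.α)
    (hD : IsDecision M.T I C) (hX : IsFundProcess P 𝓕 B M H.x I C X)
    (hopt : ∀ (I₀ : ℝ → ℝ) (X₀ : ℝ → Ω → ℝ), IsDecision M.T I₀ C →
      IsFundProcess P 𝓕 B M H.x I₀ C X₀ →
      rationalObjective P M H C X₀ ≤ rationalObjective P M H C X) :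
    ∀ᵐ t ∂(volume.restrict (Icc 0 M.T)),
      H.α * M.σ ^ 2 * (Real.exp (M.r * (M.T - t)) * I t) = M.v := by
  have hTm : M.T ∈ Icc 0 M.T := right_mem_Icc.2 hT
  set e : ℝ → ℝ := fun t => Real.exp (M.r * (M.T - t)) with he
  have hec : Continuous e := by fun_prop
  have hIi : IntervalIntegrable I volume 0 M.T := hD.intervalIntegrable_investment hTm
  have hgi : ∀ b ∈ Icc 0 M.T, ∫ t in (0 : ℝ)..b,
      (H.α * M.σ ^ 2 * (e t ^ 2 * I t) - M.v * e t) = 0 := by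
    intro b hb
    have hcv : ∀ f : ℝ → ℝ, ∫ t in (0 : ℝ)..M.T, (Ioc 0 b).indicator f t
        = ∫ t in (0 : ℝ)..b, f t := fun f => by
      rw [intervalIntegral.integral_of_le hT, intervalIntegral.integral_of_le hb.1,
        setIntegral_indicator measurableSet_Ioc,
        inter_eq_self_of_subset_right (Ioc_subset_Ioc_right hb.2)]
    set p := ∫ t in (0 : ℝ)..b, e t with hp
    set q := ∫ t in (0 : ℝ)..b, e t ^ 2 * I t with hq
    set w := ∫ t in (0 : ℝ)..b, e t ^ 2 with hw
    have hindi : ∀ {f : ℝ → ℝ}, IntervalIntegrable f volume 0 M.T →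
        IntervalIntegrable ((Ioc 0 b).indicator f) volume 0 M.T := fun hf =>
      ⟨hf.1.indicator measurableSet_Ioc, hf.2.indicator measurableSet_Ioc⟩
    -- `α φ(δ)` is the change of `logMarginal` when `δ` is added to `I` on `(0, b]`. Utility
    -- decreases in it, so optimality means `φ ≥ 0 = φ 0`.
    set φ : ℝ → ℝ := fun δ => (H.α * M.σ ^ 2 * q - M.v * p) * δ + H.α * M.σ ^ 2 / 2 * w * δ ^ 2
      with hφ
    have hnonneg : ∀ δ, 0 ≤ φ δ := by
      intro δ
      have hind : MemLp ((Ioc 0 b).indicator fun _ : ℝ => δ) 2 (volume.restrict (Icc 0 M.T)) :=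
        (memLp_const δ).indicator measurableSet_Ioc
      have hD' : IsDecision M.T (fun u => I u + (Ioc 0 b).indicator (fun _ => δ) u) C :=
        ⟨hD.investment.add hind, hD.consumption, hD.consumption_pos⟩
      obtain ⟨X', hX'⟩ := hX.exists_perturbation h𝓕 hB hT hD hb.1 δ
        (k := fun _ => 0) (integrable_zero _ _ _)
      simp only [add_zero] at hX'
      have hle := hopt _ X' hD' hX'
      have hmean : terminalMean M H.x (fun u => I u + (Ioc 0 b).indicator (fun _ => δ) u) C
          = terminalMean M H.x I C + δ * (M.v * p) := by
        have : ∀ t, Real.exp (M.r * (M.T - t))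
            * (M.v * (I t + (Ioc 0 b).indicator (fun _ => δ) t) - C t)
            = Real.exp (M.r * (M.T - t)) * (M.v * I t - C t)
              + δ * M.v * (Ioc 0 b).indicator e t := fun t => by
          by_cases htA : t ∈ Ioc 0 b
          · simp only [indicator_of_mem htA, he]; ring
          · simp only [indicator_of_notMem htA]; ring
        simp only [terminalMean, this]
        rw [intervalIntegral.integral_add, intervalIntegral.integral_const_mul, hcv]
        · ring
        · exact ((hIi.const_mul _).sub
            (hD.intervalIntegrable_consumption hTm)).continuousOn_mul hec.continuousOn
        · exact (hindi (hec.intervalIntegrable _ _)).const_mul _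
      have hvar : terminalVariance M (fun u => I u + (Ioc 0 b).indicator (fun _ => δ) u)
          = terminalVariance M I + (2 * δ * q + δ ^ 2 * w) := by
        have : ∀ t, (Real.exp (M.r * (M.T - t)) * (I t + (Ioc 0 b).indicator (fun _ => δ) t)) ^ 2
            = (Real.exp (M.r * (M.T - t)) * I t) ^ 2
              + (2 * δ * (Ioc 0 b).indicator (fun t => e t ^ 2 * I t) t
              + δ ^ 2 * (Ioc 0 b).indicator (fun t => e t ^ 2) t) := fun t => by
          by_cases htA : t ∈ Ioc 0 b
          · simp only [indicator_of_mem htA, he]; ring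
          · simp only [indicator_of_notMem htA]; ring
        have i1 : IntervalIntegrable (fun t => e t ^ 2 * I t) volume 0 M.T :=
          hIi.continuousOn_mul (by fun_prop)
        have i2 : IntervalIntegrable (fun t => e t ^ 2) volume 0 M.T :=
          (hec.pow 2).intervalIntegrable _ _
        have i3 : IntervalIntegrable (fun t => (Real.exp (M.r * (M.T - t)) * I t) ^ 2)
            volume 0 M.T := by
          rw [intervalIntegrable_iff_integrableOn_Icc_of_le hT]
          exact (memLp_continuous_mul hec hD.investment).integrable_sq
        simp only [terminalVariance, this]
        rw [intervalIntegral.integral_add i3 (((hindi i1).const_mul _).add ((hindi i2).const_mul _)),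
          intervalIntegral.integral_add ((hindi i1).const_mul _) ((hindi i2).const_mul _),
          intervalIntegral.integral_const_mul, intervalIntegral.integral_const_mul, hcv, hcv]
      simp only [rationalObjective] at hle
      rw [hX'.integral_fundUtility h𝓕 hB hT hσ hD', hX.integral_fundUtility h𝓕 hB hT hσ hD,
        hmean, hvar, add_le_add_iff_right,
        mul_le_mul_left_of_neg (neg_lt_zero.2 (one_div_pos.2 hα)), Real.exp_le_exp] at hle
      have : 0 ≤ H.α * φ δ := by simp only [hφ]; linarith
      exact nonneg_of_mul_nonneg_right this hα
    have hmin : IsLocalMin φ 0 := Eventually.of_forall fun δ => by simpa [hφ] using hnonneg δ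
    have hder : HasDerivAt φ ((H.α * M.σ ^ 2 * q - M.v * p) * 1
        + H.α * M.σ ^ 2 / 2 * w * ((2 : ℕ) * 0 ^ (2 - 1))) 0 := by
      refine ((hasDerivAt_id (0 : ℝ)).const_mul _).add (HasDerivAt.const_mul _ ?_)
      exact hasDerivAt_pow 2 (0 : ℝ)
    have h0 := hmin.hasDerivAt_eq_zero hder
    have hIb := hD.intervalIntegrable_investment hb
    have hIe : IntervalIntegrable (fun t => e t ^ 2 * I t) volume 0 b :=
      hIb.continuousOn_mul (hec.pow 2).continuousOn
    rw [intervalIntegral.integral_sub (hIe.const_mul _)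
        ((hec.intervalIntegrable _ _).const_mul _),
      intervalIntegral.integral_const_mul, intervalIntegral.integral_const_mul]
    simpa using h0
  have hae := ae_eq_zero_of_forall_integral_eq_zero hT
    (((hIi.continuousOn_mul (hec.pow 2).continuousOn).const_mul _).sub
      ((hec.intervalIntegrable _ _).const_mul _)) hgi
  filter_upwards [hae] with t ht
  have h1 : e t * (H.α * M.σ ^ 2 * (e t * I t) - M.v) = 0 := by
    simp only [Pi.zero_apply, Pi.pow_apply] at ht
    linarith
  rcases mul_eq_zero.1 h1 with h2 | h2
  · exact absurd h2 (Real.exp_pos _).ne'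
  · linarith

end Optimality

/-! ### The mean-variance identity -/

/-- The mean-variance identity that relates the marginal utilities of two decisions, of which the
first one satisfies the first order condition for investment. -/
theorem logMarginal_sub_logMarginal {M : Market} {H : Household} (hT : 0 ≤ M.T)
    {I C I' C' : ℝ → ℝ} (hD : IsDecision M.T I C) (hD' : IsDecision M.T I' C')
    (hI : ∀ᵐ t ∂(volume.restrict (Icc 0 M.T)),
      H.α * M.σ ^ 2 * (Real.exp (M.r * (M.T - t)) * I t) = M.v)
    {c : ℝ} (hC : ∀ᵐ t ∂(volume.restrict (Icc 0 M.T)), C t - C' t = c) :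
    logMarginal M H I' C' - logMarginal M H I C
      = H.α ^ 2 * M.σ ^ 2 / 2 *
          (∫ t in (0 : ℝ)..M.T, Real.exp (2 * M.r * (M.T - t)) * (I' t - I t) ^ 2)
        - H.α * c * ∫ t in (0 : ℝ)..M.T, Real.exp (M.r * (M.T - t)) := by
  have hTm : M.T ∈ Icc 0 M.T := right_mem_Icc.2 hT
  set e : ℝ → ℝ := fun t => Real.exp (M.r * (M.T - t)) with he
  have hec : Continuous e := by fun_prop
  have hsq : ∀ {f : ℝ → ℝ}, MemLp f 2 (volume.restrict (Icc 0 M.T)) →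
      IntervalIntegrable (fun t => (e t * f t) ^ 2) volume 0 M.T := fun hf => by
    rw [intervalIntegrable_iff_integrableOn_Icc_of_le hT]
    exact (memLp_continuous_mul hec hf).integrable_sq
  have hlin : ∀ {I C : ℝ → ℝ}, IsDecision M.T I C →
      IntervalIntegrable (fun t => e t * (M.v * I t - C t)) volume 0 M.T := fun hD =>
    (((hD.intervalIntegrable_investment hTm).const_mul _).sub
      (hD.intervalIntegrable_consumption hTm)).continuousOn_mul hec.continuousOn
  have h2 : ∀ t, Real.exp (2 * M.r * (M.T - t)) * (I' t - I t) ^ 2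
      = (e t * (I' t - I t)) ^ 2 := fun t => by
    rw [mul_pow, he, ← Real.exp_nat_mul]
    push_cast
    ring_nf
  have key : ∫ t in (0 : ℝ)..M.T, ((-H.α) * (e t * (M.v * I' t - C' t))
        + H.α ^ 2 * M.σ ^ 2 / 2 * (e t * I' t) ^ 2
        - ((-H.α) * (e t * (M.v * I t - C t)) + H.α ^ 2 * M.σ ^ 2 / 2 * (e t * I t) ^ 2))
      = ∫ t in (0 : ℝ)..M.T, (H.α ^ 2 * M.σ ^ 2 / 2 * (e t * (I' t - I t)) ^ 2
        - H.α * c * e t) := by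
    refine intervalIntegral.integral_congr_ae_restrict ?_
    rw [uIoc_of_le hT]
    filter_upwards [ae_restrict_of_ae_restrict_of_subset Ioc_subset_Icc_self hI,
      ae_restrict_of_ae_restrict_of_subset Ioc_subset_Icc_self hC] with t h3 h4
    have h5 : C t = c + C' t := by linarith
    have h6 : H.α * M.σ ^ 2 * (e t * I t) = M.v := h3
    -- Replacing `v` by `α σ² e I` turns the linear term in `I' - I` into the cross term that
    -- completes the square.
    rw [h5, ← h6]
    ring
  have i1 := hlin hD
  have i2 := hlin hD'
  have i3 := hsq hD.investment
  have i4 := hsq hD'.investment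
  have i5 : IntervalIntegrable (fun t => (e t * (I' t - I t)) ^ 2) volume 0 M.T :=
    hsq (hD'.investment.sub hD.investment)
  rw [intervalIntegral.integral_sub ((i2.const_mul _).add (i4.const_mul _))
      ((i1.const_mul _).add (i3.const_mul _)),
    intervalIntegral.integral_add (i2.const_mul _) (i4.const_mul _),
    intervalIntegral.integral_add (i1.const_mul _) (i3.const_mul _),
    intervalIntegral.integral_sub (i5.const_mul _) ((hec.intervalIntegrable _ _).const_mul _)] at key
  simp only [intervalIntegral.integral_const_mul] at key
  simp only [h2, logMarginal, terminalMean, terminalVariance]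
  linear_combination key

end Herding

end

/-! ### The crowding-out consumption -/

theorem theorem3 {Ω : Type*} [mΩ : MeasurableSpace Ω] (P : Measure Ω) [IsProbabilityMeasure P]
    -- a complete filtered probability space with a standard Brownian motion
    (𝓕 : Filtration ℝ mΩ) (h𝓕 : ∀ A : Set Ω, P A = 0 → MeasurableSet[𝓕 0] A)
    (M : Herding.Market) (B : ℝ → Ω → ℝ) (hB : Herding.IsBrownianOn P 𝓕 M.T B)
    (hT : 0 < M.T) (hr : M.r ≠ 0) (hσ : 0 < M.σ) (hρ : 0 < M.ρ)
    -- the following household and the leading household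
    (H₁ H₂ : Herding.Household)
    (hα₁ : 0 < H₁.α) (hβ₁ : 0 < H₁.β) (hγ₁ : 0 < H₁.γ)
    (hα₂ : 0 < H₂.α) (hβ₂ : 0 < H₂.β) (hγ₂ : 0 < H₂.γ)
    (θ : ℝ) (hθ : 0 ≤ θ)
    -- the rational decisions of both, and the optimal decision of the follower
    (Ibar₁ Cbar₁ Ibar₂ Cbar₂ Istar₁ Cstar₁ : ℝ → ℝ)
    (hbar₂ : Herding.IsRationalDecision P 𝓕 B M H₂ Ibar₂ Cbar₂)
    (hbar₁ : Herding.IsRationalDecision P 𝓕 B M H₁ Ibar₁ Cbar₁)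
    (hstar₁ : Herding.IsHerdingDecision P 𝓕 B M H₁ θ Ibar₂ Istar₁ Cstar₁) :
    ∃ c : ℝ,
      (∀ᵐ t ∂(volume.restrict (Icc 0 M.T)), Cbar₁ t - Cstar₁ t = c) ∧
      (ContinuousOn Cbar₁ (Icc 0 M.T) → ContinuousOn Cstar₁ (Icc 0 M.T) →
        ∀ t ∈ Icc 0 M.T, Cbar₁ t - Cstar₁ t = c) ∧
      c = H₁.α * M.σ ^ 2 / 2 * (H₁.β / H₁.α + (Real.exp (M.r * M.T) - 1) / M.r)⁻¹ *
        ∫ t in (0 : ℝ)..M.T, Real.exp (2 * M.r * (M.T - t)) * (Istar₁ t - Ibar₁ t) ^ 2 ∧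
      0 ≤ c := by
  obtain ⟨hDbar, Xbar, hXbar, hoptbar⟩ := hbar₁
  obtain ⟨hDstar, Xstar, hXstar, hoptstar⟩ := hstar₁
  have hCbar := Herding.consumption_foc h𝓕 hB hT.le hσ hα₁ hβ₁ hDbar hXbar
    fun C₀ X₀ => hoptbar _ C₀ X₀
  -- When only consumption varies, the herding penalty is the same on both sides and cancels.
  have hCstar := Herding.consumption_foc h𝓕 hB hT.le hσ hα₁ hβ₁ hDstar hXstar
    fun C₀ X₀ h h' => by
      have := hoptstar _ C₀ X₀ h h'
      simpa only [Herding.herdingObjective, sub_le_sub_iff_right] using this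
  have hIbar := Herding.investment_foc h𝓕 hB hT.le hσ hα₁ hDbar hXbar
    fun I₀ X₀ => hoptbar I₀ _ X₀
  set c := (Herding.logMarginal M H₁ Istar₁ Cstar₁ - Herding.logMarginal M H₁ Ibar₁ Cbar₁) / H₁.β
    with hc
  have hae : ∀ᵐ t ∂(volume.restrict (Icc 0 M.T)), Cbar₁ t - Cstar₁ t = c := by
    filter_upwards [hCbar, hCstar] with t h1 h2
    have h3 := congrArg Real.log h1
    have h4 := congrArg Real.log h2
    rw [Real.log_mul hγ₁.ne' (Real.exp_pos _).ne', ← Real.exp_add, Real.log_exp,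
      Real.log_exp] at h3 h4
    rw [hc, eq_div_iff hβ₁.ne']
    linarith
  have hdiff := Herding.logMarginal_sub_logMarginal hT.le hDbar hDstar hIbar hae
  set Q := ∫ t in (0 : ℝ)..M.T, Real.exp (2 * M.r * (M.T - t)) * (Istar₁ t - Ibar₁ t) ^ 2 with hQ
  have hann : ∫ t in (0 : ℝ)..M.T, Real.exp (M.r * (M.T - t))
      = (Real.exp (M.r * M.T) - 1) / M.r := by
    rw [eq_div_iff hr, mul_comm, Herding.mul_integral_exp]
  -- Rewriting the quotient as an integral of an exponential settles both signs of `r`.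
  have hpos : 0 < H₁.β / H₁.α + (Real.exp (M.r * M.T) - 1) / M.r := by
    rw [← hann]
    have : 0 ≤ ∫ t in (0 : ℝ)..M.T, Real.exp (M.r * (M.T - t)) :=
      intervalIntegral.integral_nonneg hT.le fun t _ => (Real.exp_pos _).le
    have := div_pos hβ₁ hα₁
    linarith
  have hQ0 : 0 ≤ Q := intervalIntegral.integral_nonneg hT.le fun t _ =>
    mul_nonneg (Real.exp_pos _).le (sq_nonneg _)
  have hceq : c = H₁.α * M.σ ^ 2 / 2
      * (H₁.β / H₁.α + (Real.exp (M.r * M.T) - 1) / M.r)⁻¹ * Q := by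
    -- The left side becomes `c * β`, so `hdiff` is a linear equation for `c`.
    rw [hann, ← div_mul_cancel₀ (_ - _) hβ₁.ne', ← hc] at hdiff
    rw [mul_right_comm, ← div_eq_mul_inv, eq_div_iff hpos.ne']
    have h1 : H₁.α * (c * (H₁.β / H₁.α + (Real.exp (M.r * M.T) - 1) / M.r))
        = c * H₁.β + H₁.α * c * ((Real.exp (M.r * M.T) - 1) / M.r) := by
      field_simp
    refine mul_left_cancel₀ hα₁.ne' ?_
    rw [h1, hdiff]
    ring
  refine ⟨c, hae, fun h1 h2 => ?_, hceq, ?_⟩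
  · exact Measure.eqOn_Icc_of_ae_eq (g := fun _ => c) volume hT.ne hae (h1.sub h2)
      continuousOn_const
  · rw [hceq]
    have := inv_pos.2 hpos
    positivity
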